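/- **Instance.** Let $G=(V,E)$ be a finite directed graph (without parallel edges) with $n=|V|$ nodes and $m=|E|$ edges, $V=\{v_1=s,\dots,v_n=t\}$ with $s\ne t$, such that $s$ has no incoming edges, $t$ has no outgoing edges, and every node other than $t$ has out-degree greater than $1$. Let $\delta(i)$ be the out-degree of $v_i$, fix an arbitrary order of the children of each node, and let $v_{c(i,j)}$ be the $((j \bmod \delta(i))+1)$-th child of $v_i$. Let $\ddagger,\#,\$$ and $W=\{w_1,\dots,w_{n-1}\}$ be additional letters. Put $A_{i,j}=w_i\,v_{c(i,j)}\,w_i$ and $B_{i,j}=v_{c(i,j)}\,w_i\,v_{c(i,j+1)}$ for $1\le i\le n-1$, $1\le j\le\delta(i)$, further $C_1=\ddagger\,\#\,w_1$, $C_i=v_i\,\#\,w_i$ for $2\le i\le n-1$, $C_n=v_n\,\#\,\$$, and let $\mathcal T$ be the set of all these strings of length three. **Encoding.** Assign distinct bit strings of a common length to the letters of $V\cup W$. For $u\in V\cup W$ let $b(u)$ be obtained from the bit string of $u$ by applying the morphism $0\mapsto 01$, $1\mapsto 10$ and prepending $01000011$; let $\ell'$ be the common length of the strings $b(u)$, and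 let $\overline{b(u)}$ be $b(u)$ with all bits flipped. Let $\circ$ be a wildcard. For a character $i$ let $g_i$ be the morphism $0\mapsto\circ$, $1\mapsto i$, and let $$f_{L,i}(x)=g_i(b(x))\,g_i(\overline{b(x)})\,\circ^{\ell'},\qquad f_{M,i}(x)=g_i(\overline{b(x)})\,\circ^{\ell'}\,g_i(b(x)),\qquad f_{R,i}(x)=\circ^{\ell'}\,g_i(b(x))\,g_i(\overline{b(x)})$$ for $x \in V\cup W$, and $f_{L,i}(\ddagger)=f_{M,i}(\#)=f_{R,i}(\$)=i^{3\ell'}$. Let $\mathcal T'$ consist of the strings $f_{L,i}(x)f_{M,i}(y)f_{R,i}(z)$ for $xyz\in\mathcal T$, the strings $f_{M,i}(w_k)$ and $f_{L,i}(w_k)$ for $1\le k\le n-1$, and the strings $f_{M,i}(v_k)$ and $f_{R,i}(v_k)$ for $2\le k\le n$, where each of these strings is written with its own character $i$, and different strings have different characters. A string $S$ *occurs* in a string $Q$ with ending position $e$ if $|S|\le e\le |Q|$ and every non-wildcard character of $S$ equals the corresponding character of $Q[e-|S|+1..e]$ (so a wildcard of $Q$, if there is any, is matched only by a wildcard of $S$).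 **Lemma.** Let $Q$ be a string of length $(2m+3n)\cdot 3\ell'$ in which every string of $\mathcal T'$ occurs. Then every $S\in\mathcal T'$ has exactly one occurrence in $Q$, and this occurrence is block-aligned: its ending position is a multiple of $3\ell'$. -/

import Mathlib

namespace Soda

/-- An instance of the restricted directed Hamiltonian path problem on the vertex set `V`. -/
structure RDHP (V : Type*) where
  graph : Digraph V
  s : V
  t : V
  s_ne_t : s ≠ t
  no_in : ∀ u, ¬ graph.Adj u s
  no_out : ∀ u, ¬ graph.Adj t u
  two_out : ∀ u, u ≠ t → 1 < {x | graph.Adj u x}.ncard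

/-- The number `n` of nodes. -/
noncomputable def RDHP.n {V : Type*} (_P : RDHP V) : ℕ := Nat.card V

/-- The number `m` of edges. -/
noncomputable def RDHP.m {V : Type*} (P : RDHP V) : ℕ :=
  {e : V × V | P.graph.Adj e.1 e.2}.ncard

/-- An arbitrary ordering of the children of every node. -/
structure ChildOrder {V : Type*} (P : RDHP V) where
  children : V → List V
  nodup : ∀ u, (children u).Nodup
  mem_children : ∀ u x, x ∈ children u ↔ P.graph.Adj u x

namespace ChildOrder

variable {V : Type*} {P : RDHP V} (O : ChildOrder P)

/-- The out-degree `δ(u)`. -/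
def deg (u : V) : ℕ := (O.children u).length

/-- `c(u, j)`: the `((j mod δ(u)) + 1)`-th child of `u`
(the default value is only reached if `u` has no child). -/
def c (u : V) (j : ℕ) : V := (O.children u).getD (j % O.deg u) u

end ChildOrder

/-- The symbols `‡`, `#`, `$`, the nodes `v u`, and one additional letter `w u` per node
(the letter `w t` is never used). -/
inductive Sym (V : Type*) where
  | ddagger : Sym V
  | hash : Sym V
  | dollar : Sym V
  | v (u : V) : Sym V
  | w (u : V) : Sym V

/-- The set `V ∪ W`. -/
def letters {V : Type*} (P : RDHP V) : Set (Sym V) :=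
  {x | ∃ u, x = Sym.v u} ∪ {x | ∃ u, u ≠ P.t ∧ x = Sym.w u}

/-- Strings of length three over the symbols. -/
abbrev Triple (V : Type*) := Sym V × Sym V × Sym V

section Strings

variable {V : Type*} {P : RDHP V} (O : ChildOrder P)

def strA (i : V) (j : ℕ) : Triple V := (Sym.w i, Sym.v (O.c i j), Sym.w i)

def strB (i : V) (j : ℕ) : Triple V := (Sym.v (O.c i j), Sym.w i, Sym.v (O.c i (j + 1)))

/-- The set `𝒜_i`. -/
def setA (i : V) : Set (Triple V) :=
  {x | ∃ j ∈ Finset.Icc 1 (O.deg i), x = strA O i j ∨ x = strB O i j}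

/-- The set `𝒞`. -/
def setC (P : RDHP V) : Set (Triple V) :=
  {(Sym.ddagger, Sym.hash, Sym.w P.s), (Sym.v P.t, Sym.hash, Sym.dollar)} ∪
    {x | ∃ u, u ≠ P.s ∧ u ≠ P.t ∧ x = (Sym.v u, Sym.hash, Sym.w u)}

/-- The set `𝒯`. -/
def setT : Set (Triple V) := setC P ∪ {x | ∃ i, i ≠ P.t ∧ x ∈ setA O i}

end Strings

/-- Distinct bit strings of a common length `k` for the letters in `V ∪ W`. -/
structure BitCode {V : Type*} (P : RDHP V) where
  k : ℕ
  bits : Sym V → List Bool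
  length_bits : ∀ x ∈ letters P, (bits x).length = k
  injOn : Set.InjOn bits (letters P)

/-- The morphism `0 ↦ 01`, `1 ↦ 10`. -/
def phi (l : List Bool) : List Bool := l.flatMap fun b => [b, !b]

/-- `α = 01000011`. -/
def alpha : List Bool := [false, true, false, false, false, false, true, true]

/-- Flipping all bits. -/
def flip (l : List Bool) : List Bool := l.map fun b => !b

/-- Strings with wildcards: `none` is the wildcard `∘`, and `some i` is the character `i`. -/
abbrev WStr := List (Option ℕ)

/-- The morphism `0 ↦ ∘`, `1 ↦ i`. -/
def g (i : ℕ) (l : List Bool) : WStr := l.map fun b => if b then some i else none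

namespace BitCode

variable {V : Type*} {P : RDHP V} (E : BitCode P)

/-- The bit string `b(x)`, for `x` in `V ∪ W`. -/
def b (x : Sym V) : List Bool := alpha ++ phi (E.bits x)

/-- The common length `ℓ'` of the strings `b(x)`, for `x` in `V ∪ W`. -/
def len : ℕ := 8 + 2 * E.k

theorem length_b {x : Sym V} (hx : x ∈ letters P) : (E.b x).length = E.len := by
  have h : ∀ l : List Bool, (phi l).length = 2 * l.length := by
    intro l
    simp [phi, List.length_flatMap, mul_comm]
  simp [b, len, h, alpha, E.length_bits x hx]
  omega

def fL (i : ℕ) : Sym V → WStr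
  | Sym.ddagger => List.replicate (3 * E.len) (some i)
  | x => g i (E.b x) ++ g i (flip (E.b x)) ++ List.replicate E.len none

def fM (i : ℕ) : Sym V → WStr
  | Sym.hash => List.replicate (3 * E.len) (some i)
  | x => g i (flip (E.b x)) ++ List.replicate E.len none ++ g i (E.b x)

def fR (i : ℕ) : Sym V → WStr
  | Sym.dollar => List.replicate (3 * E.len) (some i)
  | x => List.replicate E.len none ++ g i (E.b x) ++ g i (flip (E.b x))

/-- The string `f(xyz)` with the character `i`. -/
def f (i : ℕ) (x : Triple V) : WStr := E.fL i x.1 ++ E.fM i x.2.1 ++ E.fR i x.2.2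

end BitCode

/-- Names of the input strings: `f(xyz)` and the patch strings `f_L(x)`, `f_M(x)`, `f_R(x)`. -/
inductive Name (V : Type*) where
  | main (x : Triple V) : Name V
  | patchL (x : Sym V) : Name V
  | patchM (x : Sym V) : Name V
  | patchR (x : Sym V) : Name V

/-- The names of the strings that make up `𝒯'`. -/
def names {V : Type*} {P : RDHP V} (O : ChildOrder P) : Set (Name V) :=
  {y | ∃ x ∈ setT O, y = Name.main x} ∪
  {y | ∃ u, u ≠ P.t ∧ (y = Name.patchM (Sym.w u) ∨ y = Name.patchL (Sym.w u))} ∪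
  {y | ∃ u, u ≠ P.s ∧ (y = Name.patchM (Sym.v u) ∨ y = Name.patchR (Sym.v u))}

/-- The string with a given name and character `i`. -/
def BitCode.str {V : Type*} {P : RDHP V} (E : BitCode P) (i : ℕ) : Name V → WStr
  | Name.main x => E.f i x
  | Name.patchL x => E.fL i x
  | Name.patchM x => E.fM i x
  | Name.patchR x => E.fR i x

/-- The set `𝒯'`, for an assignment `ι` of characters (IDs) to the input strings. -/
def setT' {V : Type*} {P : RDHP V} (O : ChildOrder P) (E : BitCode P) (ι : Name V → ℕ) :
    Set WStr :=
  {S | ∃ y ∈ names O, S = E.str (ι y) y}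

/-- The pattern `S` matches the text `T` of the same length: every position of `S` is a wildcard
or agrees with `T`. A wildcard of the text is an unfilled position, which only a wildcard of the
pattern matches. -/
def Matches (S T : WStr) : Prop := List.Forall₂ (fun x y => x = none ∨ x = y) S T

/-- `S` occurs in `Q` with ending position `e` (positions are counted from `1`). -/
def OccursEndingAt (S Q : WStr) (e : ℕ) : Prop :=
  S.length ≤ e ∧ e ≤ Q.length ∧ Matches S ((Q.take e).drop (e - S.length))

/-- `S` has a match in `Q`. -/
def HasMatch (S Q : WStr) : Prop := ∃ e, OccursEndingAt S Q e

end Soda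

/-! The proof is a counting argument followed by two rounds of forced alignment. A code word and its
flip have `ℓ'` non-wildcards together, so the strings for `A` and `B` have `3ℓ'` each, the `C`
strings have `5ℓ'` each plus `2ℓ'` extra for each of `s` and `t`, and the `4(n-1)` patch strings
have `ℓ'` each. The sum is `(6m + 9n)ℓ'`, the length of `Q` (`le_sum_weight`). Different strings use
different characters, so their non-wildcards never share a position. Hence they tile `Q` exactly
(`IsPlacement.isTiling`).

Scanning the tiling from left to right, the prefix `01000011` leaves no way to start a piece off the
grid of width `ℓ'`: a shifted code word or flipped code word would collide with whatever fills the
gaps (`IsTiling.dvd`). On the grid, each column is a full piece or a complementary pair `b(x)`,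
flipped `b(x)`. For this the code words must form an antichain, which the morphism `0 ↦ 01`, `1 ↦
10` provides.

A second scan, by blocks of three columns, shows that each block is full or holds a left, a middle
and a right pattern (`IsCellTiling.aligned_of_lt`). Only one ambiguity remains: a left patch can sit
one column late, filling the place of a right part, and a right patch one column early, filling that
of a left part. Both are excluded by counting: in `V` letters the encoded triples already have as
many left parts as there are middle parts, and in `W` letters as many right parts (`right_mod`,
`left_mod`).

Uniqueness uses the tiling but not the alignment: in each placement every position of `Q` is
covered, and its character names the string that covers it. So the first non-wildcards of two
occurrences of one string coincide (`IsPlacement.le`, in both directions). -/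

namespace Soda

/-- The pieces of length `ℓ'` from which the input strings are composed: a run of wildcards,
a code word, a flipped code word, or a run of non-wildcards. -/
inductive Piece (X : Type*) where
  | blank : Piece X
  | pos (x : X) : Piece X
  | neg (x : X) : Piece X
  | full : Piece X

/-- Whether a piece has a non-wildcard at offset `r`. -/
def Piece.bit {X : Type*} (b : X → ℕ → Bool) : Piece X → ℕ → Bool
  | .blank, _ => false
  | .pos x, r => b x r
  | .neg x, r => !b x r
  | .full, _ => true

/-- The sequence of pieces `c`, placed at position `s`, has a non-wildcard at position `p`. -/
def Covers {X : Type*} (b : X → ℕ → Bool) (l : ℕ) (c : ℕ → Piece X) (s p : ℕ) : Prop :=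
  ∃ q r, r < l ∧ (c q).bit b r = true ∧ s + q * l + r = p

/-- The sequences `c y`, placed at the positions `s y`, cover each of the first `N` positions,
and no position is covered twice. -/
structure IsTiling {X I : Type*} (b : X → ℕ → Bool) (l N : ℕ) (c : I → ℕ → Piece X)
    (s : I → ℕ) : Prop where
  unique : ∀ {y z p}, Covers b l (c y) (s y) p → Covers b l (c z) (s z) p → y = z
  exists_cover : ∀ p < N, ∃ y, Covers b l (c y) (s y) p

/-- The code words `b x` of length `l` start with `alpha`, and no code word of a letter in `A` is
dominated by another one. -/
structure IsCode {X : Type*} (A : Set X) (b : X → ℕ → Bool) (l : ℕ) : Prop where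
  eight_le : 8 ≤ l
  b_zero : ∀ x, b x 0 = false
  b_one : ∀ x, b x 1 = true
  b_two : ∀ x, b x 2 = false
  b_four : ∀ x, b x 4 = false
  b_five : ∀ x, b x 5 = false
  b_six : ∀ x, b x 6 = true
  b_seven : ∀ x, b x 7 = true
  exists_lt : ∀ x ∈ A, ∀ y ∈ A, x ≠ y → ∃ r < l, b x r = true ∧ b y r = false

/-- All letters of the sequence of pieces are in `A`. -/
def LettersIn {X : Type*} (A : Set X) (c : ℕ → Piece X) : Prop :=
  ∀ q x, c q = .pos x ∨ c q = .neg x → x ∈ A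

/-! ### Alignment to multiples of the piece length -/

section

variable {X I : Type*} {A : Set X} {b : X → ℕ → Bool} {l N : ℕ} {c : I → ℕ → Piece X} {s : I → ℕ}

theorem covers_of_bit {d : ℕ → Piece X} {t p : ℕ} {q r : ℕ} (hr : r < l)
    (h : (d q).bit b r = true) (hp : t + q * l + r = p) : Covers b l d t p :=
  ⟨q, r, hr, h, hp⟩

/-- A sequence placed at a multiple of `l` covers `k * l + r` through its piece at `k * l`. -/
theorem Covers.exists_piece {d : ℕ → Piece X} {t k r : ℕ} (hl : 0 < l) (ht : l ∣ t) (hr : r < l)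
    (h : Covers b l d t (k * l + r)) : ∃ q, t + q * l = k * l ∧ (d q).bit b r = true := by
  obtain ⟨q, r', hr', hb, he⟩ := h
  obtain ⟨a, rfl⟩ := ht
  have h1 : (a + q) * l + r' = k * l + r := by rw [← he]; ring
  have h2 : a + q = k := by
    have := congrArg (· / l) h1
    simpa [Nat.add_div_of_dvd_right, Nat.mul_div_cancel _ hl, Nat.div_eq_of_lt hr,
      Nat.div_eq_of_lt hr'] using this
  subst h2
  have h3 : r' = r := by omega
  subst h3
  exact ⟨q, by ring, hb⟩

namespace IsCode

theorem bit_zero (hb : IsCode A b l) {x : Piece X} (h : x.bit b 0 = true) :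
    (∃ a, x = .neg a) ∨ x = .full := by
  cases x <;> simp_all [Piece.bit, hb.b_zero]

theorem bit_one (hb : IsCode A b l) {x : Piece X} (h : x.bit b 1 = true) :
    (∃ a, x = .pos a) ∨ x = .full := by
  cases x <;> simp_all [Piece.bit, hb.b_one]

end IsCode

open Classical in
/-- The first position that is covered by a sequence that starts with a non-blank piece. -/
noncomputable def firstPos (d : ℕ → Piece X) (t : ℕ) : ℕ :=
  -- Code words begin with `01`, so only these skip position `t`; flipped code words and full pieces
  -- cover it.
  t + if ∃ x, d 0 = .pos x then 1 else 0

theorem firstPos_le (hb : IsCode A b l) {d : ℕ → Piece X} {t p : ℕ} (h : Covers b l d t p) :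
    firstPos d t ≤ p := by
  obtain ⟨q, r, hr, hbit, he⟩ := h
  unfold firstPos
  split_ifs with h0
  · obtain ⟨x, hx⟩ := h0
    by_contra hlt
    have hq : q = 0 := by
      by_contra hq
      have := Nat.le_mul_of_pos_left l (Nat.pos_of_ne_zero hq)
      have := hb.eight_le
      omega
    subst hq
    have hr0 : r = 0 := by omega
    subst hr0
    simp [hx, Piece.bit, hb.b_zero] at hbit
  · omega

theorem firstPos_cases {d : ℕ → Piece X} (t : ℕ) (h : d 0 ≠ .blank) :
    (firstPos d t = t + 1 ∧ ∃ x, d 0 = .pos x) ∨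
      (firstPos d t = t ∧ ((∃ x, d 0 = .neg x) ∨ d 0 = .full)) := by
  unfold firstPos
  cases hd : d 0 <;> simp_all

theorem covers_firstPos (hb : IsCode A b l) {d : ℕ → Piece X} (t : ℕ) (h : d 0 ≠ .blank) :
    Covers b l d t (firstPos d t) := by
  have := hb.eight_le
  rcases firstPos_cases t h with ⟨h1, x, hx⟩ | ⟨h1, ⟨x, hx⟩ | hx⟩ <;> rw [h1]
  · exact covers_of_bit (q := 0) (r := 1) (by omega) (by simp [hx, Piece.bit, hb.b_one]) (by simp)
  · exact covers_of_bit (q := 0) (r := 0) (by omega) (by simp [hx, Piece.bit, hb.b_zero]) (by simp)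
  · exact covers_of_bit (q := 0) (r := 0) (by omega) (by simp [hx, Piece.bit]) (by simp)

theorem covers_add {d : ℕ → Piece X} {t r : ℕ}
    (hr : r < l) (h : (d 0).bit b r = true) : Covers b l d t (t + r) :=
  covers_of_bit (q := 0) hr h (by simp)

/-- If all sequences that begin before `k * l` are placed at multiples of `l`, then no sequence
that starts with a code word is placed at `k * l - 1`. -/
theorem IsTiling.not_pos_before (hb : IsCode A b l) (hT : IsTiling b l N c s)
    (hc : ∀ y, c y 0 ≠ .blank) {k : ℕ} (hk : k * l + l ≤ N)
    (ih : ∀ y, firstPos (c y) (s y) < k * l → l ∣ s y) {y : I} {x : X} (hx : c y 0 = .pos x)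
    (hy : s y + 1 = k * l) : False := by
  have h8 := hb.eight_le
  have c5 : Covers b l (c y) (s y) (k * l + 5) := by
    have := covers_add (b := b) (d := c y) (t := s y) (r := 6) (l := l) (by omega)
      (by simp [hx, Piece.bit, hb.b_six])
    convert this using 1; omega
  have c6 : Covers b l (c y) (s y) (k * l + 6) := by
    have := covers_add (b := b) (d := c y) (t := s y) (r := 7) (l := l) (by omega)
      (by simp [hx, Piece.bit, hb.b_seven])
    convert this using 1; omega
  have hfy : firstPos (c y) (s y) = k * l := by
    rcases firstPos_cases (s y) (hc y) with ⟨h, -⟩ | ⟨-, ⟨z, hz⟩ | hz⟩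
    · omega
    · simp [hx] at hz
    · simp [hx] at hz
  have cy : Covers b l (c y) (s y) (k * l) := hfy ▸ covers_firstPos hb (s y) (hc y)
  -- The prefix `01000011` of `y` starts at `k * l - 1`: it covers `k * l`, `k * l + 5`, `k * l + 6`
  -- and leaves a gap at `k * l + 1`. If the gap is filled by an aligned code word or full piece, or
  -- by a code word starting at `k * l`, this hits `k * l + 6`; a flipped code word or full piece
  -- starting at `k * l + 1` hits `k * l + 5`.
  obtain ⟨z, hz⟩ := hT.exists_cover (k * l + 1) (by omega)
  have hle := firstPos_le hb hz
  have hzy : z ≠ y := by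
    rintro rfl
    obtain ⟨q, r, hr, hbit, he⟩ := hz
    have hq : q = 0 := by
      by_contra hq
      have := Nat.le_mul_of_pos_left l (Nat.pos_of_ne_zero hq)
      omega
    subst hq
    have : r = 2 := by omega
    subst this
    simp [hx, Piece.bit, hb.b_two] at hbit
  by_cases h1 : firstPos (c z) (s z) < k * l
  · obtain ⟨q, hq, hbit⟩ := hz.exists_piece (by omega) (ih z h1) (by omega)
    refine hzy (hT.unique (covers_of_bit (q := q) (r := 6) (by omega) ?_ (by omega)) c6)
    rcases hb.bit_one hbit with ⟨a, ha⟩ | ha <;> simp [ha, Piece.bit, hb.b_six]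
  by_cases h2 : firstPos (c z) (s z) = k * l
  · exact hzy (hT.unique (h2 ▸ covers_firstPos hb (s z) (hc z)) cy)
  rcases firstPos_cases (s z) (hc z) with ⟨h, a, ha⟩ | ⟨h, ha⟩
  · refine hzy (hT.unique (covers_of_bit (q := 0) (r := 6) (by omega) ?_ (by omega)) c6)
    simp [ha, Piece.bit, hb.b_six]
  · refine hzy (hT.unique (covers_of_bit (q := 0) (r := 4) (by omega) ?_ (by omega)) c5)
    rcases ha with ⟨a, ha⟩ | ha <;> simp [ha, Piece.bit, hb.b_four]

/-- Two non-overlapping pieces `neg x` and `pos x'` at the same place have the same letter. -/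
theorem IsTiling.letter_eq (hb : IsCode A b l) (hT : IsTiling b l N c s)
    (hA : ∀ y, LettersIn A (c y)) {y z : I} {q q' k : ℕ} {x x' : X}
    (hy : s y + q * l = k) (hyx : c y q = .neg x) (hz : s z + q' * l = k)
    (hzx : c z q' = .pos x') : x = x' := by
  by_contra hne
  obtain ⟨r, hr, h1, h2⟩ := hb.exists_lt x' (hA z q' x' (.inl hzx)) x (hA y q x (.inr hyx))
    (Ne.symm hne)
  have hyz : y = z := hT.unique (p := k + r)
    (covers_of_bit (q := q) hr (by simp [hyx, Piece.bit, h2]) (by omega))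
    (covers_of_bit (q := q') hr (by simp [hzx, Piece.bit, h1]) (by omega))
  subst hyz
  have h8 := hb.eight_le
  have : q = q' := Nat.eq_of_mul_eq_mul_right (by omega) (by omega : q * l = q' * l)
  subst this
  simp [hyx] at hzx

/-- Induction along the text. The strings covering `k * l` and `k * l + 1` are forced onto the grid,
and together their pieces at `k * l` fill all `l` positions. So any string whose first covered
position lies there is one of these two. -/
theorem IsTiling.dvd_of_firstPos_lt (hb : IsCode A b l) (hT : IsTiling b l N c s)
    (hc : ∀ y, c y 0 ≠ .blank) (hA : ∀ y, LettersIn A (c y)) {K : ℕ} (hN : N = K * l)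
    (hs : ∀ y, firstPos (c y) (s y) < N) (k : ℕ) :
    ∀ y, firstPos (c y) (s y) < k * l → l ∣ s y := by
  have h8 := hb.eight_le
  induction k with
  | zero => intro y hy; omega
  | succ k ih =>
    intro y hy
    by_cases hold : firstPos (c y) (s y) < k * l
    · exact ih y hold
    have hkK : k + 1 ≤ K := by
      have h1 : k * l < K * l := by have := hs y; omega
      exact Nat.lt_of_mul_lt_mul_right h1
    have hk : k * l + l ≤ N := by
      have := Nat.mul_le_mul_right l hkK
      rw [hN]; linarith [Nat.succ_mul k l]
    obtain ⟨r, hr, hyr⟩ : ∃ r, r < l ∧ firstPos (c y) (s y) = k * l + r :=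
      ⟨firstPos (c y) (s y) - k * l, by rw [Nat.succ_mul] at hy; omega, by omega⟩
    have hcy : Covers b l (c y) (s y) (k * l + r) := hyr ▸ covers_firstPos hb (s y) (hc y)
    obtain ⟨u, hu⟩ := hT.exists_cover (k * l) (by omega)
    have hul : l ∣ s u := by
      have hle := firstPos_le hb hu
      by_cases h1 : firstPos (c u) (s u) < k * l
      · exact ih u h1
      · rcases firstPos_cases (s u) (hc u) with ⟨h, a, ha⟩ | ⟨h, ha⟩
        · exact (hT.not_pos_before hb hc hk ih ha (by omega)).elim
        · exact ⟨k, by rw [mul_comm]; omega⟩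
    -- Only flipped code words and full pieces cover their offset 0. A full piece leaves room for no
    -- other string.
    obtain ⟨q, hq, hbit⟩ := Covers.exists_piece (r := 0) (by omega) hul (by omega) hu
    rcases hb.bit_zero hbit with ⟨x, hx⟩ | hx
    swap
    · have : y = u := hT.unique hcy
        (covers_of_bit (q := q) (r := r) hr (by simp [hx, Piece.bit]) (by omega))
      exact this ▸ hul
    obtain ⟨v, hv⟩ := hT.exists_cover (k * l + 1) (by omega)
    have hvl : l ∣ s v := by
      have hle := firstPos_le hb hv
      by_cases h1 : firstPos (c v) (s v) < k * l
      · exact ih v h1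
      by_cases h2 : firstPos (c v) (s v) = k * l
      · have : v = u := hT.unique (h2 ▸ covers_firstPos hb (s v) (hc v)) hu
        exact this ▸ hul
      rcases firstPos_cases (s v) (hc v) with ⟨h, a, ha⟩ | ⟨h, ha⟩
      · exact ⟨k, by rw [mul_comm]; omega⟩
      -- A flipped code word or full piece starting at `k * l + 1` covers `k * l + 5` by its offset
      -- 4, which the piece of `u` covers by its offset 5.
      · have huv : v = u := hT.unique (p := k * l + 5)
          (covers_of_bit (q := 0) (r := 4) (by omega)
            (by rcases ha with ⟨a, ha⟩ | ha <;> simp [ha, Piece.bit, hb.b_four]) (by omega))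
          (covers_of_bit (q := q) (r := 5) (by omega) (by simp [hx, Piece.bit, hb.b_five])
            (by omega))
        have := firstPos_le hb hu
        rw [← huv] at this
        omega
    obtain ⟨q', hq', hbit'⟩ := hv.exists_piece (by omega) hvl (by omega)
    rcases hb.bit_one hbit' with ⟨x', hx'⟩ | hx'
    swap
    · have : y = v := hT.unique hcy
        (covers_of_bit (q := q') (r := r) hr (by simp [hx', Piece.bit]) (by omega))
      exact this ▸ hvl
    -- With equal letters the two pieces are complementary, so the value of `b x r` decides which of
    -- `u` and `v` covers the position of `y`.
    obtain rfl := hT.letter_eq hb hA hq hx hq' hx'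
    cases hxr : b x r with
    | true =>
      have : y = v := hT.unique hcy
        (covers_of_bit (q := q') (r := r) hr (by simp [hx', Piece.bit, hxr]) (by omega))
      exact this ▸ hvl
    | false =>
      have : y = u := hT.unique hcy
        (covers_of_bit (q := q) (r := r) hr (by simp [hx, Piece.bit, hxr]) (by omega))
      exact this ▸ hul

/-- Dropping leading blank pieces changes no covered position. This reduces right patches, which
begin with a blank, to sequences that begin with a non-blank piece. -/
theorem covers_shift {d : ℕ → Piece X} {t p a : ℕ} (ha : ∀ j < a, d j = .blank) :
    Covers b l (fun q => d (q + a)) (t + a * l) p ↔ Covers b l d t p := by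
  constructor
  · rintro ⟨q, r, hr, hbit, he⟩
    exact ⟨q + a, r, hr, hbit, by rw [← he]; ring⟩
  · rintro ⟨q, r, hr, hbit, he⟩
    by_cases hq : q < a
    · simp [ha q hq, Piece.bit] at hbit
    · obtain ⟨j, rfl⟩ : ∃ j, q = j + a := ⟨q - a, by omega⟩
      exact ⟨j, r, hr, hbit, by rw [← he]; ring⟩

/-- In a tiling, all sequences are placed at multiples of the length of the pieces. -/
theorem IsTiling.dvd (hb : IsCode A b l) (hT : IsTiling b l N c s) {a : I → ℕ}
    (ha : ∀ y, ∀ j < a y, c y j = .blank) (hc : ∀ y, c y (a y) ≠ .blank)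
    (hA : ∀ y, LettersIn A (c y)) {K : ℕ} (hN : N = K * l)
    (hs : ∀ y, s y + a y * l + l ≤ N) (y : I) : l ∣ s y := by
  have hT' : IsTiling b l N (fun y q => c y (q + a y)) (fun y => s y + a y * l) :=
    ⟨fun h h' => hT.unique ((covers_shift (ha _)).1 h) ((covers_shift (ha _)).1 h'),
      fun p hp => (hT.exists_cover p hp).imp fun y h => (covers_shift (ha y)).2 h⟩
  have h8 := hb.eight_le
  have hfirst : ∀ y, firstPos (fun q => c y (q + a y)) (s y + a y * l) < N := by
    intro y
    have := hs y
    rcases firstPos_cases (d := fun q => c y (q + a y)) (s y + a y * l) (by simpa using hc y)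
      with ⟨h, -⟩ | ⟨h, -⟩ <;> omega
  have := hT'.dvd_of_firstPos_lt hb (fun y => by simpa using hc y)
    (fun y q x h => hA y _ x h) hN hfirst K y (hN ▸ hfirst y)
  exact (Nat.dvd_add_left (Dvd.intro_left (a y) rfl)).1 this

/-! ### Columns of one piece length -/

/-- The piece in column `q` of a sequence that is placed at column `t`. -/
def cell (d : ℕ → Piece X) (t q : ℕ) : Piece X := if t ≤ q then d (q - t) else .blank

theorem cell_add (d : ℕ → Piece X) (t q : ℕ) : cell d t (t + q) = d q := by simp [cell]

/-- Each of the first `n` columns holds a full piece, or a code word and its flipped version. -/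
structure IsCellTiling (n : ℕ) (e : I → ℕ → Piece X) : Prop where
  exists_cell : ∀ q < n,
    (∃ y, e y q = .full) ∨ ∃ x y z, e y q = .pos x ∧ e z q = .neg x
  pos_unique : ∀ {q y z x x'}, e y q = .pos x → e z q = .pos x' → y = z
  neg_unique : ∀ {q y z x x'}, e y q = .neg x → e z q = .neg x' → y = z
  full_unique : ∀ {q y z}, e y q = .full → e z q ≠ .blank → y = z

theorem covers_of_cell {d : ℕ → Piece X} {t q r : ℕ} (hr : r < l)
    (h : (cell d t q).bit b r = true) : Covers b l d (t * l) (q * l + r) := by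
  unfold cell at h
  split_ifs at h with hq
  · refine ⟨q - t, r, hr, h, ?_⟩
    rw [← Nat.add_mul]; congr 2; omega
  · simp [Piece.bit] at h

theorem Covers.bit_cell {d : ℕ → Piece X} {t q r : ℕ} (hr : r < l)
    (h : Covers b l d (t * l) (q * l + r)) : (cell d t q).bit b r = true := by
  obtain ⟨j, hj, hbit⟩ := h.exists_piece (by omega) (Dvd.intro_left t rfl) hr
  have : t + j = q := Nat.eq_of_mul_eq_mul_right (by omega : 0 < l) (by linarith [Nat.add_mul t j l])
  rwa [← this, cell_add]

/-- On the grid, offsets 0 and 1 decide everything: offset 0 is covered by flipped code words and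
full pieces, offset 1 by code words and full pieces. -/
theorem IsTiling.isCellTiling (hb : IsCode A b l) (hT : IsTiling b l N c s)
    (hA : ∀ y, LettersIn A (c y)) {K : ℕ} (hN : N = K * l) {τ : I → ℕ}
    (hτ : ∀ y, s y = τ y * l) : IsCellTiling K fun y => cell (c y) (τ y) := by
  have h8 := hb.eight_le
  have hcov : ∀ {y q r}, r < l → (cell (c y) (τ y) q).bit b r = true →
      Covers b l (c y) (s y) (q * l + r) := fun {y q r} hr h => hτ y ▸ covers_of_cell hr h
  have hlet : ∀ {q y z x x'}, cell (c y) (τ y) q = .neg x → cell (c z) (τ z) q = .pos x' →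
      x = x' := by
    intro q y z x x' hy hz
    unfold cell at hy hz
    split_ifs at hy hz with h1 h2
    refine hT.letter_eq hb hA (k := q * l) ?_ hy ?_ hz
    · rw [hτ, ← Nat.add_mul]; congr 1; omega
    · rw [hτ, ← Nat.add_mul]; congr 1; omega
  refine ⟨?_, ?_, ?_, ?_⟩
  · intro q hq
    have hqN : q * l + l ≤ N := by
      have := Nat.mul_le_mul_right l (Nat.succ_le_of_lt hq)
      rw [hN]; linarith [Nat.succ_mul q l]
    obtain ⟨u, hu⟩ := hT.exists_cover (q * l + 0) (by omega)
    obtain ⟨v, hv⟩ := hT.exists_cover (q * l + 1) (by omega)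
    rw [hτ] at hu hv
    rcases hb.bit_zero (hu.bit_cell (by omega)) with ⟨x, hx⟩ | hx
    · rcases hb.bit_one (hv.bit_cell (by omega)) with ⟨x', hx'⟩ | hx'
      · exact .inr ⟨x, v, u, hlet hx hx' ▸ hx', hx⟩
      · exact .inl ⟨v, hx'⟩
    · exact .inl ⟨u, hx⟩
  · intro q y z x x' hy hz
    exact hT.unique (hcov (q := q) (r := 1) (by omega) (by simp [hy, Piece.bit, hb.b_one]))
      (hcov (r := 1) (by omega) (by simp [hz, Piece.bit, hb.b_one]))
  · intro q y z x x' hy hz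
    exact hT.unique (hcov (q := q) (r := 0) (by omega) (by simp [hy, Piece.bit, hb.b_zero]))
      (hcov (r := 0) (by omega) (by simp [hz, Piece.bit, hb.b_zero]))
  · intro q y z hy hz
    obtain ⟨r, hr, hbit⟩ : ∃ r < l, (cell (c z) (τ z) q).bit b r = true := by
      cases h : cell (c z) (τ z) q with
      | blank => exact absurd h hz
      | pos x => exact ⟨1, by omega, by simp [Piece.bit, hb.b_one]⟩
      | neg x => exact ⟨0, by omega, by simp [Piece.bit, hb.b_zero]⟩
      | full => exact ⟨0, by omega, rfl⟩
    exact hT.unique (hcov hr (by simp [hy, Piece.bit])) (hcov hr hbit)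

/-- A column with a code word and its flipped version holds nothing else. -/
theorem IsCellTiling.eq_or_eq {n : ℕ} {e : I → ℕ → Piece X} (hT : IsCellTiling n e)
    {q : ℕ} {y z u : I} {x x' : X} (hy : e y q = .pos x) (hz : e z q = .neg x')
    (hu : e u q ≠ .blank) : u = y ∨ u = z := by
  cases h : e u q with
  | blank => exact absurd h hu
  | pos a => exact .inl (hT.pos_unique h hy)
  | neg a => exact .inr (hT.neg_unique h hz)
  | full => exact .inl (hT.full_unique h (by simp [hy]))

end

/-! ### Alignment to blocks of three columns -/

/-- The kinds of input strings: the encoded triples and the three kinds of patch strings. -/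
inductive Kind where
  | main : Kind
  | left : Kind
  | middle : Kind
  | right : Kind

section

variable {X I : Type*}

/-- The three pieces `x`, `y`, `z` stand in `d` at offset `o`. -/
def HasBlock (d : ℕ → Piece X) (o : ℕ) (x y z : Piece X) : Prop :=
  d o = x ∧ d (o + 1) = y ∧ d (o + 2) = z

/-- The possible sequences of pieces for each kind of strings. -/
def HasShape : Kind → (ℕ → Piece X) → Prop
  | .main, d =>
      (HasBlock d 0 .full .full .full ∨ ∃ x, HasBlock d 0 (.pos x) (.neg x) .blank) ∧
      (HasBlock d 3 .full .full .full ∨ ∃ x, HasBlock d 3 (.neg x) .blank (.pos x)) ∧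
      (HasBlock d 6 .full .full .full ∨ ∃ x, HasBlock d 6 .blank (.pos x) (.neg x)) ∧
      ∀ j, 9 ≤ j → d j = .blank
  | .left, d => (∃ x, HasBlock d 0 (.pos x) (.neg x) .blank) ∧ ∀ j, 3 ≤ j → d j = .blank
  | .middle, d => (∃ x, HasBlock d 0 (.neg x) .blank (.pos x)) ∧ ∀ j, 3 ≤ j → d j = .blank
  | .right, d => (∃ x, HasBlock d 0 .blank (.pos x) (.neg x)) ∧ ∀ j, 3 ≤ j → d j = .blank

/-- The number of blank pieces at the beginning. -/
def Kind.lead : Kind → ℕ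
  | .right => 1
  | _ => 0

/-- The number of pieces. -/
def Kind.size : Kind → ℕ
  | .main => 9
  | _ => 3

/-- A string of the given kind, placed at column `t`, is aligned to blocks of three columns, where
a patch string may be shifted inside its block as long as its non-blank pieces stay there. -/
def Kind.Aligned : Kind → ℕ → Prop
  | .main, t => t % 3 = 0
  | .left, t => t % 3 ≠ 2
  | .middle, t => t % 3 = 0
  | .right, t => t % 3 ≠ 1

theorem HasBlock.cell {d : ℕ → Piece X} {o : ℕ} {x y z : Piece X} (h : HasBlock d o x y z)
    {t q : ℕ} (hq : t + o = q) : HasBlock (cell d t) q x y z := by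
  subst hq
  refine ⟨?_, ?_, ?_⟩
  · rw [cell_add]; exact h.1
  · rw [add_assoc, cell_add]; exact h.2.1
  · rw [add_assoc, cell_add]; exact h.2.2

theorem cell_eq_blank {d : ℕ → Piece X} {m t q : ℕ} (hd : ∀ j, m ≤ j → d j = .blank)
    (hq : t + m ≤ q) : cell d t q = .blank := by
  unfold cell
  split_ifs
  · exact hd _ (by omega)
  · rfl

theorem HasShape.lead_ne {κ : Kind} {d : ℕ → Piece X} (h : HasShape κ d) :
    d κ.lead ≠ .blank := by
  cases κ
  · rcases h.1 with h | ⟨x, h⟩ <;> simp [Kind.lead, h.1]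
  · obtain ⟨⟨x, h⟩, -⟩ := h; simp [Kind.lead, h.1]
  · obtain ⟨⟨x, h⟩, -⟩ := h; simp [Kind.lead, h.1]
  · obtain ⟨⟨x, h⟩, -⟩ := h
    have := h.2.1
    simp only [zero_add] at this
    simp [Kind.lead, this]

theorem HasShape.eq_blank_of_lt {κ : Kind} {d : ℕ → Piece X} (h : HasShape κ d) {j : ℕ}
    (hj : j < κ.lead) : d j = .blank := by
  cases κ <;> simp only [Kind.lead, Nat.not_lt_zero] at hj
  obtain ⟨⟨x, h⟩, -⟩ := h
  obtain rfl : j = 0 := by omega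
  exact h.1

theorem HasShape.lead_le {κ : Kind} {d : ℕ → Piece X} (h : HasShape κ d) {t q : ℕ}
    (hq : cell d t q ≠ .blank) : t + κ.lead ≤ q := by
  by_contra hlt
  apply hq
  unfold cell
  split_ifs
  · exact h.eq_blank_of_lt (by omega)
  · rfl

/-- What an aligned string that starts before a block contributes to this block. -/
theorem HasShape.block_of_old {κ : Kind} {d : ℕ → Piece X} (h : HasShape κ d) {t k : ℕ}
    (ht : κ.Aligned t) (hk : t + κ.lead < 3 * k) :
    HasBlock (cell d t) (3 * k) .blank .blank .blank ∨
    HasBlock (cell d t) (3 * k) .full .full .full ∨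
    (∃ x, HasBlock (cell d t) (3 * k) (.neg x) .blank (.pos x)) ∨
    ∃ x, HasBlock (cell d t) (3 * k) .blank (.pos x) (.neg x) := by
  cases κ <;> simp only [Kind.Aligned, Kind.lead] at ht hk
  · obtain ⟨-, hM, hR, hE⟩ := h
    by_cases h1 : t + 3 = 3 * k
    · rcases hM with hM | ⟨x, hM⟩
      · exact .inr (.inl (hM.cell h1))
      · exact .inr (.inr (.inl ⟨x, hM.cell h1⟩))
    by_cases h2 : t + 6 = 3 * k
    · rcases hR with hR | ⟨x, hR⟩
      · exact .inr (.inl (hR.cell h2))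
      · exact .inr (.inr (.inr ⟨x, hR.cell h2⟩))
    exact .inl ⟨cell_eq_blank hE (by omega), cell_eq_blank hE (by omega),
      cell_eq_blank hE (by omega)⟩
  · obtain ⟨⟨x, hx⟩, hE⟩ := h
    -- The third piece of a left patch may fall into the next block when the patch is shifted, but
    -- it is blank.
    have hE' : ∀ j, 2 ≤ j → d j = .blank := by
      intro j hj
      rcases Nat.eq_or_lt_of_le hj with rfl | hj
      · exact hx.2.2
      · exact hE j hj
    exact .inl ⟨cell_eq_blank hE' (by omega), cell_eq_blank hE' (by omega),
      cell_eq_blank hE' (by omega)⟩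
  · obtain ⟨-, hE⟩ := h
    exact .inl ⟨cell_eq_blank hE (by omega), cell_eq_blank hE (by omega),
      cell_eq_blank hE (by omega)⟩
  · obtain ⟨-, hE⟩ := h
    exact .inl ⟨cell_eq_blank hE (by omega), cell_eq_blank hE (by omega),
      cell_eq_blank hE (by omega)⟩

/-- A string that starts with a full piece. -/
theorem HasShape.of_full {κ : Kind} {d : ℕ → Piece X} (h : HasShape κ d)
    {t q : ℕ} (hq : t + κ.lead = q) (hx : cell d t q = .full) :
    κ = .main ∧ t = q ∧ HasBlock (cell d t) q .full .full .full := by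
  subst hq
  rw [cell_add] at hx
  cases κ
  · refine ⟨rfl, rfl, ?_⟩
    rcases h.1 with h | ⟨a, h⟩
    · exact h.cell rfl
    · have := hx ▸ h.1; simp at this
  all_goals
    obtain ⟨⟨a, h1, h2, h3⟩, -⟩ := h
    simp_all [Kind.lead]

/-- A string that starts with a flipped code word. -/
theorem HasShape.of_neg {κ : Kind} {d : ℕ → Piece X} (h : HasShape κ d) {x : X}
    {t q : ℕ} (hq : t + κ.lead = q) (hx : cell d t q = .neg x) :
    κ = .middle ∧ t = q ∧ HasBlock (cell d t) q (.neg x) .blank (.pos x) := by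
  subst hq
  rw [cell_add] at hx
  cases κ
  · rcases h.1 with h | ⟨a, h⟩ <;> have := hx ▸ h.1 <;> simp at this
  · obtain ⟨⟨a, h⟩, -⟩ := h; have := hx ▸ h.1; simp at this
  · obtain ⟨⟨a, h⟩, -⟩ := h
    have := hx ▸ h.1
    simp only [Piece.neg.injEq] at this
    subst this
    exact ⟨rfl, rfl, h.cell rfl⟩
  · obtain ⟨⟨a, h⟩, -⟩ := h; have := hx ▸ h.2.1; simp at this

/-- A string that starts with a code word. -/
theorem HasShape.of_pos {κ : Kind} {d : ℕ → Piece X} (h : HasShape κ d) {x : X}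
    {t q : ℕ} (hq : t + κ.lead = q) (hx : cell d t q = .pos x) :
    cell d t (q + 1) = .neg x ∧ (κ = .main ∧ t = q ∨ κ = .left ∧ t = q ∨
      κ = .right ∧ t + 1 = q) := by
  subst hq
  rw [cell_add] at hx
  cases κ
  · refine ⟨?_, by simp [Kind.lead]⟩
    rcases h.1 with h | ⟨a, h⟩
    · have := hx ▸ h.1; simp at this
    · have := hx ▸ h.1
      simp only [Piece.pos.injEq] at this
      subst this
      exact (h.cell rfl).2.1
  · refine ⟨?_, by simp [Kind.lead]⟩
    obtain ⟨⟨a, h⟩, -⟩ := h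
    have := hx ▸ h.1
    simp only [Piece.pos.injEq] at this
    subst this
    exact (h.cell rfl).2.1
  · obtain ⟨⟨a, h⟩, -⟩ := h; have := hx ▸ h.1; simp at this
  · refine ⟨?_, by simp [Kind.lead]⟩
    obtain ⟨⟨a, h⟩, -⟩ := h
    have := hx ▸ h.2.1
    simp only [Piece.pos.injEq] at this
    subst this
    exact (h.cell rfl).2.2

variable {n : ℕ} {c : I → ℕ → Piece X} {τ : I → ℕ} {κ : I → Kind}

/-- An encoded triple whose code word starts in the second column of a block leaves the first
column of the next block uncovered. -/
theorem IsCellTiling.not_main_second (hT : IsCellTiling n fun y => cell (c y) (τ y))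
    (hκ : ∀ y, HasShape (κ y) (c y)) (hn : ∀ y, τ y + (κ y).size ≤ n) {k : ℕ} {x : I}
    (ih : ∀ y, τ y + (κ y).lead < 3 * k + 3 → y ≠ x → (κ y).Aligned (τ y))
    (hx : κ x = .main) (hτ : τ x = 3 * k + 1) {a : X}
    (ha : cell (c x) (τ x) (3 * k + 1) = .pos a) : False := by
  have hsh := hκ x
  rw [hx] at hsh
  obtain ⟨hL, hM, -, -⟩ := hsh
  have h3 : cell (c x) (τ x) (3 * k + 3) = .blank := by
    rcases hL with hL | ⟨z, hL⟩
    · have := (hL.cell (q := 3 * k + 1) (by omega)).1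
      simp [ha] at this
    · exact (hL.cell (q := 3 * k + 1) (by omega)).2.2
  have h4 : cell (c x) (τ x) (3 * k + 4) = .full ∨ ∃ z, cell (c x) (τ x) (3 * k + 4) = .neg z := by
    rcases hM with hM | ⟨z, hM⟩
    · exact .inl (hM.cell (by omega)).1
    · exact .inr ⟨z, (hM.cell (by omega)).1⟩
  have h4b : cell (c x) (τ x) (3 * k + 4) ≠ .blank := by
    rcases h4 with h | ⟨z, h⟩ <;> simp [h]
  have hsize := hn x
  rw [hx, Kind.size] at hsize
  -- The string `x` is blank in column `3 * k + 3` and starts its middle part, full or flipped, in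
  -- the next one. Whatever brings a full piece or a code word to column `3 * k + 3` continues with
  -- a full piece or a flipped code word, and collides with that middle part.
  have key : ∀ u, cell (c u) (τ u) (3 * k + 3) = .full ∨
      (∃ z, cell (c u) (τ u) (3 * k + 3) = .pos z) → False := by
    intro u hu
    have hux : u ≠ x := by
      rintro rfl
      rcases hu with hu | ⟨z, hu⟩ <;> simp [h3] at hu
    have hub : cell (c u) (τ u) (3 * k + 3) ≠ .blank := by
      rcases hu with hu | ⟨z, hu⟩ <;> simp [hu]
    have hle := (hκ u).lead_le hub
    have hfull : cell (c u) (τ u) (3 * k + 4) ≠ .full := fun h =>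
      hux (hT.full_unique (q := 3 * k + 4) h h4b)
    by_cases hold : τ u + (κ u).lead < 3 * k + 3
    · rcases (hκ u).block_of_old (k := k + 1) (ih u hold hux) (by omega) with
        h | h | ⟨z, h⟩ | ⟨z, h⟩
      · exact hub h.1
      · exact hfull h.2.1
      · rcases hu with hu | ⟨z, hu⟩ <;> simp [hu, show 3 * (k + 1) = 3 * k + 3 by ring,
          HasBlock] at h
      · exact hub h.1
    · rcases hu with hu | ⟨z, hu⟩
      · exact hfull ((hκ u).of_full (by omega) hu).2.2.2.1
      · have hneg := ((hκ u).of_pos (by omega) hu).1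
        rcases h4 with h | ⟨w, h⟩
        · exact hux (hT.full_unique (q := 3 * k + 4) h (by simp [hneg])).symm
        · exact hux (hT.neg_unique (q := 3 * k + 4) hneg h)
  rcases hT.exists_cell (3 * k + 3) (by omega) with ⟨u, hu⟩ | ⟨z, u, -, hu, -⟩
  · exact key u (.inl hu)
  · exact key u (.inr ⟨z, hu⟩)

/-- All strings of a tiling are aligned, up to shifts of the patch strings inside a block. -/
theorem IsCellTiling.aligned_of_lt (hT : IsCellTiling n fun y => cell (c y) (τ y))
    (hκ : ∀ y, HasShape (κ y) (c y)) (hn : ∀ y, τ y + (κ y).size ≤ n) {K : ℕ} (hK : n = 3 * K)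
    (k : ℕ) : ∀ y, τ y + (κ y).lead < 3 * k → (κ y).Aligned (τ y) := by
  induction k with
  | zero => intro y hy; omega
  | succ k ih =>
    intro u hu
    by_cases hold : τ u + (κ u).lead < 3 * k
    · exact ih u hold
    have hlead : ∀ y, cell (c y) (τ y) (τ y + (κ y).lead) ≠ .blank := fun y => by
      rw [cell_add]; exact (hκ y).lead_ne
    have hkn : 3 * k + 3 ≤ n := by
      have h1 := hn u
      have h2 : (κ u).lead < (κ u).size := by cases κ u <;> simp [Kind.lead, Kind.size]
      omega
    rcases hT.exists_cell (3 * k) (by omega) with ⟨y, hy⟩ | ⟨a, z, y, hz, hy⟩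
    · -- The block is full.
      have hle := (hκ y).lead_le (t := τ y) (q := 3 * k) (by simp [hy])
      have hblock : HasBlock (cell (c y) (τ y)) (3 * k) .full .full .full := by
        by_cases hyo : τ y + (κ y).lead < 3 * k
        · rcases (hκ y).block_of_old (ih y hyo) hyo with h | h | ⟨b, h⟩ | ⟨b, h⟩
          · have := hy ▸ h.1; simp at this
          · exact h
          · have := hy ▸ h.1; simp at this
          · have := hy ▸ h.1; simp at this
        · exact ((hκ y).of_full (by omega) hy).2.2
      have hyu : y = u := by
        obtain h | h | h : τ u + (κ u).lead = 3 * k ∨ τ u + (κ u).lead = 3 * k + 1 ∨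
          τ u + (κ u).lead = 3 * k + 2 := by omega
        · exact hT.full_unique hblock.1 (h ▸ hlead u)
        · exact hT.full_unique hblock.2.1 (h ▸ hlead u)
        · exact hT.full_unique hblock.2.2 (h ▸ hlead u)
      subst hyu
      obtain ⟨hm, ht, -⟩ := (hκ y).of_full (q := 3 * k) (by omega) hy
      rw [hm, ht]; simp [Kind.Aligned]
    have hyle := (hκ y).lead_le (t := τ y) (q := 3 * k) (by simp [hy])
    have hzle := (hκ z).lead_le (t := τ z) (q := 3 * k) (by simp [hz])
    -- The flipped word in the first column can only open a middle pattern, so `y` also fixes the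
    -- code word in the third column.
    have hyA : (κ y).Aligned (τ y) ∧
        HasBlock (cell (c y) (τ y)) (3 * k) (.neg a) .blank (.pos a) := by
      by_cases hyo : τ y + (κ y).lead < 3 * k
      · refine ⟨ih y hyo, ?_⟩
        rcases (hκ y).block_of_old (ih y hyo) hyo with h | h | ⟨b, h⟩ | ⟨b, h⟩
        · have := hy ▸ h.1; simp at this
        · have := hy ▸ h.1; simp at this
        · have := hy ▸ h.1
          simp only [Piece.neg.injEq] at this
          exact this ▸ h
        · have := hy ▸ h.1; simp at this
      · obtain ⟨hm, ht, hblock⟩ := (hκ y).of_neg (q := 3 * k) (by omega) hy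
        refine ⟨?_, hblock⟩
        rw [hm, ht]; simp [Kind.Aligned]
    -- No earlier aligned string has a code word in a first column, so `z` starts here, possibly as
    -- a right patch placed one column early.
    have hzA : (κ z).Aligned (τ z) ∧ cell (c z) (τ z) (3 * k + 1) = .neg a := by
      by_cases hzo : τ z + (κ z).lead < 3 * k
      · rcases (hκ z).block_of_old (ih z hzo) hzo with h | h | ⟨b, h⟩ | ⟨b, h⟩ <;>
          have := hz ▸ h.1 <;> simp at this
      · obtain ⟨hneg, hm⟩ := (hκ z).of_pos (q := 3 * k) (by omega) hz
        refine ⟨?_, hneg⟩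
        rcases hm with ⟨hm, ht⟩ | ⟨hm, ht⟩ | ⟨hm, ht⟩ <;> rw [hm] <;>
          simp only [Kind.Aligned] <;> omega
    obtain ⟨b, x, hx⟩ : ∃ b x, cell (c x) (τ x) (3 * k + 1) = .pos b := by
      rcases hT.exists_cell (3 * k + 1) (by omega) with ⟨x, hx⟩ | ⟨b, x, -, hx, -⟩
      · have := hT.full_unique hx (z := z) (by simp [hzA.2])
        subst this
        have := hzA.2 ▸ hx
        simp at this
      · exact ⟨b, x, hx⟩
    have hxle := (hκ x).lead_le (t := τ x) (q := 3 * k + 1) (by simp [hx])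
    have hxy : x ≠ y := by
      rintro rfl
      have := hx ▸ hyA.2.2.1
      simp at this
    have hxz : x ≠ z := by
      rintro rfl
      have := hx ▸ hzA.2
      simp at this
    -- The code word in the second column is followed by its flip in the third. The only misaligned
    -- possibility is an encoded triple starting in the second column; it is postponed until the
    -- other strings starting in this block are known to be aligned.
    have hxA : ((κ x).Aligned (τ x) ∨ κ x = .main ∧ τ x = 3 * k + 1) ∧
        cell (c x) (τ x) (3 * k + 2) = .neg b := by
      by_cases hxo : τ x + (κ x).lead < 3 * k
      · refine ⟨.inl (ih x hxo), ?_⟩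
        rcases (hκ x).block_of_old (ih x hxo) hxo with h | h | ⟨e, h⟩ | ⟨e, h⟩
        · have := hx ▸ h.2.1; simp at this
        · have := hx ▸ h.2.1; simp at this
        · have := hx ▸ h.2.1; simp at this
        · have := hx ▸ h.2.1
          simp only [Piece.pos.injEq] at this
          exact this ▸ h.2.2
      by_cases hx0 : τ x + (κ x).lead = 3 * k
      · rcases hT.eq_or_eq hz hy (u := x) (hx0 ▸ hlead x) with h | h
        · exact absurd h hxz
        · exact absurd h hxy
      · obtain ⟨hneg, hm⟩ := (hκ x).of_pos (q := 3 * k + 1) (by omega) hx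
        refine ⟨?_, hneg⟩
        rcases hm with hm | ⟨hm, ht⟩ | ⟨hm, ht⟩
        · exact .inr hm
        all_goals
          left
          rw [hm]
          simp only [Kind.Aligned]
          omega
    -- All three columns are now complementary pairs formed by `x`, `y`, `z`, so no further string
    -- can start in the block.
    have hmem : ∀ v, ¬ τ v + (κ v).lead < 3 * k → τ v + (κ v).lead < 3 * k + 3 →
        v = x ∨ v = y ∨ v = z := by
      intro v h1 h2
      obtain h | h | h : τ v + (κ v).lead = 3 * k ∨ τ v + (κ v).lead = 3 * k + 1 ∨
        τ v + (κ v).lead = 3 * k + 2 := by omega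
      · have := hT.eq_or_eq hz hy (h ▸ hlead v); tauto
      · have := hT.eq_or_eq hx hzA.2 (h ▸ hlead v); tauto
      · have := hT.eq_or_eq hyA.2.2.2 hxA.2 (h ▸ hlead v); tauto
    have hxA' : (κ x).Aligned (τ x) := by
      rcases hxA.1 with h | ⟨hm, ht⟩
      · exact h
      refine (hT.not_main_second hκ hn (fun v hv hvx => ?_) hm ht hx).elim
      by_cases hvo : τ v + (κ v).lead < 3 * k
      · exact ih v hvo
      rcases hmem v hvo hv with rfl | rfl | rfl
      · exact absurd rfl hvx
      · exact hyA.1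
      · exact hzA.1
    rcases hmem u hold (by omega) with rfl | rfl | rfl
    · exact hxA'
    · exact hyA.1
    · exact hzA.1

theorem IsCellTiling.aligned (hT : IsCellTiling n fun y => cell (c y) (τ y))
    (hκ : ∀ y, HasShape (κ y) (c y)) (hn : ∀ y, τ y + (κ y).size ≤ n) {K : ℕ} (hK : n = 3 * K)
    (y : I) : (κ y).Aligned (τ y) := by
  refine hT.aligned_of_lt hκ hn hK K y ?_
  have h1 := hn y
  have h2 : (κ y).lead < (κ y).size := by cases κ y <;> simp [Kind.lead, Kind.size]
  omega

/-- In the first column of a block, flipped code words belong to middle parts. -/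
theorem HasShape.neg_first {κ : Kind} {d : ℕ → Piece X} (h : HasShape κ d) {t q : ℕ} {x : X}
    (ht : κ.Aligned t) (hq : q % 3 = 0) (hx : cell d t q = .neg x) :
    κ = .main ∧ q = t + 3 ∧ d 3 = .neg x ∨ κ = .middle ∧ q = t ∧ d 0 = .neg x := by
  obtain ⟨k, rfl⟩ : ∃ k, q = 3 * k := ⟨q / 3, by omega⟩
  have hle := h.lead_le (t := t) (q := 3 * k) (by simp [hx])
  by_cases hold : t + κ.lead < 3 * k
  · obtain ⟨j, hj⟩ : ∃ j, 3 * k = t + j := ⟨3 * k - t, by omega⟩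
    have hdj : d j = .neg x := by rwa [hj, cell_add] at hx
    cases κ <;> simp only [Kind.Aligned, Kind.lead] at ht hold
    · left
      obtain ⟨-, hM, hR, hE⟩ := h
      have h9 : j < 9 := by
        by_contra h9
        simp [hE j (by omega)] at hdj
      obtain rfl | rfl : j = 3 ∨ j = 6 := by omega
      · exact ⟨rfl, hj, hdj⟩
      · rcases hR with hR | ⟨a, hR⟩ <;> simp [hR.1] at hdj
    · obtain ⟨⟨a, h0, h1, h2⟩, hE⟩ := h
      by_cases h3 : 3 ≤ j
      · simp [hE j h3] at hdj
      · obtain rfl : j = 2 := by omega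
        simp [h2] at hdj
    all_goals
      simp [h.2 j (by omega)] at hdj
  · right
    obtain ⟨h1, h2, h3⟩ := h.of_neg (by omega) hx
    subst h2
    refine ⟨h1, rfl, ?_⟩
    have := cell_add d (3 * k) 0
    rw [← this]; exact hx

/-- In the third column of a block, code words belong to middle parts. -/
theorem HasShape.pos_third {κ : Kind} {d : ℕ → Piece X} (h : HasShape κ d) {t q : ℕ} {x : X}
    (ht : κ.Aligned t) (hq : q % 3 = 2) (hx : cell d t q = .pos x) :
    κ = .main ∧ q = t + 5 ∧ d 5 = .pos x ∨ κ = .middle ∧ q = t + 2 ∧ d 2 = .pos x := by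
  have hle := h.lead_le (t := t) (q := q) (by simp [hx])
  obtain ⟨j, rfl⟩ : ∃ j, q = t + j := ⟨q - t, by omega⟩
  rw [cell_add] at hx
  cases κ <;> simp only [Kind.Aligned, Kind.lead] at ht hle
  · left
    obtain ⟨hL, hM, hR, hE⟩ := h
    have h9 : j < 9 := by
      by_contra h9
      simp [hE j (by omega)] at hx
    obtain rfl | rfl | rfl : j = 2 ∨ j = 5 ∨ j = 8 := by omega
    · rcases hL with hL | ⟨a, hL⟩ <;> have := hL.2.2 <;> simp_all
    · exact ⟨rfl, rfl, hx⟩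
    · rcases hR with hR | ⟨a, hR⟩ <;> have := hR.2.2 <;> simp_all
  · obtain ⟨⟨a, h0, h1, h2⟩, hE⟩ := h
    have h3 : j < 3 := by
      by_contra h3
      simp [hE j (by omega)] at hx
    obtain rfl | rfl : j = 1 ∨ j = 2 := by omega
    all_goals simp_all
  · have h3 : j < 3 := by
      by_contra h3
      simp [h.2 j (by omega)] at hx
    obtain rfl : j = 2 := by omega
    exact .inr ⟨rfl, rfl, hx⟩
  · obtain ⟨⟨a, h0, h1, h2⟩, hE⟩ := h
    have h3 : j < 3 := by
      by_contra h3
      simp [hE j (by omega)] at hx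
    obtain rfl | rfl : j = 0 ∨ j = 2 := by omega
    all_goals simp_all

end

/-! ### The input strings as sequences of pieces -/

section

variable {V : Type*} {P : RDHP V}

/-- Edges, given by a node and the number of a child. -/
abbrev Edge (O : ChildOrder P) := Σ u : V, Fin (O.deg u)

/-- An enumeration of the names of the input strings without repetitions. -/
inductive Idx (O : ChildOrder P) where
  | a (e : Edge O) : Idx O
  | b (e : Edge O) : Idx O
  | c (u : V) : Idx O
  | wM (u : {u : V // u ≠ P.t}) : Idx O
  | wL (u : {u : V // u ≠ P.t}) : Idx O
  | vM (u : {u : V // u ≠ P.s}) : Idx O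
  | vR (u : {u : V // u ≠ P.s}) : Idx O

open Classical in
/-- The string `C_u`. -/
noncomputable def strC (P : RDHP V) (u : V) : Triple V :=
  (if u = P.s then .ddagger else .v u, .hash, if u = P.t then .dollar else .w u)

variable {O : ChildOrder P}

namespace Idx

/-- The strings `A` and `B` are numbered from 1 to `δ`, whereas `Fin` starts at 0; hence the `+ 1`.
-/
noncomputable def name : Idx O → Name V
  | a e => .main (strA O e.1 (e.2 + 1))
  | b e => .main (strB O e.1 (e.2 + 1))
  | c u => .main (strC P u)
  | wM u => .patchM (.w u)
  | wL u => .patchL (.w u)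
  | vM u => .patchM (.v u)
  | vR u => .patchR (.v u)

def kind : Idx O → Kind
  | a _ => .main
  | b _ => .main
  | c _ => .main
  | wM _ => .middle
  | wL _ => .left
  | vM _ => .middle
  | vR _ => .right

end Idx

theorem edge_ne_t (e : Edge O) : e.1 ≠ P.t := by
  obtain ⟨u, j⟩ := e
  rintro rfl
  have hj := j.2
  have hmem : (O.children P.t)[(j : ℕ)]'hj ∈ O.children P.t := List.getElem_mem _
  rw [O.mem_children] at hmem
  exact P.no_out _ hmem

/-- The numbers `1, …, δ` are pairwise incongruent modulo `δ`, and the list of children has no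
repetitions. -/
theorem c_succ_inj {u : V} {j j' : ℕ} (hj : j < O.deg u) (hj' : j' < O.deg u)
    (h : O.c u (j + 1) = O.c u (j' + 1)) : j = j' := by
  have h0 : 0 < O.deg u := by omega
  have h1 := Nat.mod_lt (j + 1) h0
  have h2 := Nat.mod_lt (j' + 1) h0
  unfold ChildOrder.c at h
  rw [List.getD_eq_getElem _ _ h1, List.getD_eq_getElem _ _ h2] at h
  have h3 := (O.nodup u).getElem_inj_iff.1 h
  have h4 : j ≡ j' [MOD O.deg u] := Nat.ModEq.add_right_cancel' 1 h3
  exact h4.eq_of_lt_of_lt hj hj'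

theorem strC_injective : Function.Injective (strC P) := by
  intro u u' h
  simp only [strC, Prod.mk.injEq] at h
  have h1 := h.1
  split_ifs at h1 with h2 h3 h3
  · rw [h2, h3]
  · simpa using h1

theorem Idx.name_injective : Function.Injective (Idx.name : Idx O → Name V) := by
  rintro (⟨i, j⟩ | ⟨i, j⟩ | u | u | u | u | u) (⟨i', j'⟩ | ⟨i', j'⟩ | u' | u' | u' | u' | u') h <;>
    simp only [Idx.name, strA, strB, Name.main.injEq, Prod.mk.injEq, Sym.w.injEq, Sym.v.injEq,
      reduceCtorEq, and_false, Name.patchL.injEq, Name.patchM.injEq,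
      Name.patchR.injEq] at h
  · obtain ⟨rfl, h, -⟩ := h
    rw [Fin.ext (c_succ_inj j.2 j'.2 h)]
  · simp [strC] at h
  · obtain ⟨h, rfl, -⟩ := h
    rw [Fin.ext (c_succ_inj j.2 j'.2 h)]
  · simp [strC] at h
  · simp [strC] at h
  · simp [strC] at h
  · rw [strC_injective h]
  all_goals rw [Subtype.ext h]

theorem Idx.name_mem (y : Idx O) : y.name ∈ names O := by
  rcases y with e | e | u | u | u | u | u
  · exact .inl (.inl ⟨_, .inr ⟨e.1, edge_ne_t e, e.2 + 1,
      Finset.mem_Icc.2 ⟨by omega, e.2.2⟩, .inl rfl⟩, rfl⟩)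
  · exact .inl (.inl ⟨_, .inr ⟨e.1, edge_ne_t e, e.2 + 1,
      Finset.mem_Icc.2 ⟨by omega, e.2.2⟩, .inr rfl⟩, rfl⟩)
  · refine .inl (.inl ⟨_, .inl ?_, rfl⟩)
    by_cases hs : u = P.s
    · exact .inl (.inl (by simp [strC, hs, P.s_ne_t]))
    by_cases ht : u = P.t
    · exact .inl (.inr (by simp [strC, ht, P.s_ne_t.symm]))
    · exact .inr ⟨u, hs, ht, by simp [strC, hs, ht]⟩
  · exact .inl (.inr ⟨u, u.2, .inl rfl⟩)
  · exact .inl (.inr ⟨u, u.2, .inr rfl⟩)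
  · exact .inr ⟨u, u.2, .inl rfl⟩
  · exact .inr ⟨u, u.2, .inr rfl⟩

theorem Idx.exists_name_eq {x : Name V} (hx : x ∈ names O) : ∃ y : Idx O, y.name = x := by
  rcases hx with (⟨x, hx, rfl⟩ | ⟨u, hu, rfl | rfl⟩) | ⟨u, hu, rfl | rfl⟩
  · rcases hx with ((rfl | rfl) | ⟨u, hs, ht, rfl⟩) | ⟨i, -, j, hj, hx⟩
    · exact ⟨.c P.s, by simp [name, strC, P.s_ne_t]⟩
    · exact ⟨.c P.t, by simp [name, strC, P.s_ne_t.symm]⟩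
    · exact ⟨.c u, by simp [name, strC, hs, ht]⟩
    · rw [Finset.mem_Icc] at hj
      obtain ⟨k, rfl⟩ : ∃ k, j = k + 1 := ⟨j - 1, by omega⟩
      rcases hx with rfl | rfl
      · exact ⟨.a ⟨i, k, by omega⟩, rfl⟩
      · exact ⟨.b ⟨i, k, by omega⟩, rfl⟩
  · exact ⟨.wM ⟨u, hu⟩, rfl⟩
  · exact ⟨.wL ⟨u, hu⟩, rfl⟩
  · exact ⟨.vM ⟨u, hu⟩, rfl⟩
  · exact ⟨.vR ⟨u, hu⟩, rfl⟩

def piecesL : Sym V → List (Piece (Sym V))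
  | .ddagger => [.full, .full, .full]
  | x => [.pos x, .neg x, .blank]

def piecesM : Sym V → List (Piece (Sym V))
  | .hash => [.full, .full, .full]
  | x => [.neg x, .blank, .pos x]

def piecesR : Sym V → List (Piece (Sym V))
  | .dollar => [.full, .full, .full]
  | x => [.blank, .pos x, .neg x]

/-- The pieces of an input string. -/
def pieces : Name V → List (Piece (Sym V))
  | .main x => piecesL x.1 ++ piecesM x.2.1 ++ piecesR x.2.2
  | .patchL x => piecesL x
  | .patchM x => piecesM x
  | .patchR x => piecesR x

/-- The string of a piece, written with the character `i`. -/
def BitCode.render (E : BitCode P) (i : ℕ) : Piece (Sym V) → WStr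
  | .blank => List.replicate E.len none
  | .pos x => g i (E.b x)
  | .neg x => g i (flip (E.b x))
  | .full => List.replicate E.len (some i)

theorem replicate_three_mul {α : Type*} (n : ℕ) (x : α) : List.replicate (3 * n) x =
    List.replicate n x ++ (List.replicate n x ++ List.replicate n x) := by
  rw [List.replicate_append_replicate, List.replicate_append_replicate]; congr 1; ring

theorem BitCode.fL_eq (E : BitCode P) (i : ℕ) (x : Sym V) :
    E.fL i x = (piecesL x).flatMap (E.render i) := by
  cases x <;> simp [BitCode.fL, piecesL, BitCode.render, replicate_three_mul]

theorem BitCode.fM_eq (E : BitCode P) (i : ℕ) (x : Sym V) :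
    E.fM i x = (piecesM x).flatMap (E.render i) := by
  cases x <;> simp [BitCode.fM, piecesM, BitCode.render, replicate_three_mul]

theorem BitCode.fR_eq (E : BitCode P) (i : ℕ) (x : Sym V) :
    E.fR i x = (piecesR x).flatMap (E.render i) := by
  cases x <;> simp [BitCode.fR, piecesR, BitCode.render, replicate_three_mul]

theorem BitCode.str_eq (E : BitCode P) (i : ℕ) (y : Name V) :
    E.str i y = (pieces y).flatMap (E.render i) := by
  cases y <;> simp [BitCode.str, BitCode.f, pieces, E.fL_eq, E.fM_eq, E.fR_eq]

/-- The code words as functions. -/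
def BitCode.bitAt (E : BitCode P) (x : Sym V) (r : ℕ) : Bool := (E.b x).getD r false

theorem phi_getD (l : List Bool) (j : ℕ) (hj : j < l.length) :
    (phi l).getD (2 * j) false = l[j] ∧ (phi l).getD (2 * j + 1) false = !l[j] := by
  induction l generalizing j with
  | nil => simp at hj
  | cons a l ih =>
    cases j with
    | zero => simp [phi]
    | succ j =>
      have := ih j (by simpa using hj)
      simpa [phi, Nat.mul_succ] using this

theorem BitCode.bitAt_add_eight (E : BitCode P) (x : Sym V) (r : ℕ) :
    E.bitAt x (8 + r) = (phi (E.bits x)).getD r false := by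
  simp [BitCode.bitAt, BitCode.b, alpha, add_comm 8 r]

/-- The prefix conditions hold for every symbol, since `b` always prepends `alpha`. For the
antichain condition, where two bit strings differ, their images under `phi` are `01` and `10`, and
neither dominates the other. -/
theorem BitCode.isCode (E : BitCode P) : IsCode (letters P) E.bitAt E.len := by
  refine ⟨by simp [BitCode.len], fun x => rfl, fun x => rfl, fun x => rfl, fun x => rfl,
    fun x => rfl, fun x => rfl, fun x => rfl, ?_⟩
  intro x hx y hy hne
  have hb : E.bits x ≠ E.bits y := fun h => hne (E.injOn hx hy h)
  have lx := E.length_bits x hx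
  have ly := E.length_bits y hy
  obtain ⟨j, hjx, hjy, hj⟩ : ∃ (j : ℕ) (h1 : j < (E.bits x).length) (h2 : j < (E.bits y).length),
      (E.bits x)[j] ≠ (E.bits y)[j] := by
    by_contra! hall
    exact hb (List.ext_getElem (by omega) hall)
  have px := phi_getD _ j hjx
  have py := phi_getD _ j hjy
  cases hv : (E.bits x)[j] with
  | true =>
    refine ⟨8 + 2 * j, by simp only [BitCode.len]; omega, ?_, ?_⟩
    · rw [E.bitAt_add_eight, px.1, hv]
    · rw [E.bitAt_add_eight, py.1]; rw [hv] at hj; simpa using hj.symm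
  | false =>
    refine ⟨8 + (2 * j + 1), by simp only [BitCode.len]; omega, ?_, ?_⟩
    · rw [E.bitAt_add_eight, px.2, hv]; rfl
    · rw [E.bitAt_add_eight, py.2]; rw [hv] at hj; simpa using hj.symm

theorem BitCode.render_length (E : BitCode P) (i : ℕ) {p : Piece (Sym V)}
    (hp : ∀ x, p = .pos x ∨ p = .neg x → x ∈ letters P) : (E.render i p).length = E.len := by
  cases p with
  | blank => simp [BitCode.render]
  | full => simp [BitCode.render]
  | pos x => simp [BitCode.render, g, E.length_b (hp x (.inl rfl))]
  | neg x => simp [BitCode.render, g, flip, E.length_b (hp x (.inr rfl))]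

theorem BitCode.render_getElem? (E : BitCode P) (i : ℕ) {p : Piece (Sym V)}
    (hp : ∀ x, p = .pos x ∨ p = .neg x → x ∈ letters P) {r : ℕ} (hr : r < E.len)
    (hbit : p.bit E.bitAt r = true) : (E.render i p)[r]? = some (some i) := by
  cases p with
  | blank => simp [Piece.bit] at hbit
  | full => simp [BitCode.render, hr]
  | pos x =>
    have hl := E.length_b (hp x (.inl rfl))
    have hr' : r < (E.b x).length := by omega
    simp only [Piece.bit, BitCode.bitAt, List.getD_eq_getElem _ _ hr'] at hbit
    simp [BitCode.render, g, hr', hbit]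
  | neg x =>
    have hl := E.length_b (hp x (.inr rfl))
    have hr' : r < (E.b x).length := by omega
    simp only [Piece.bit, BitCode.bitAt, List.getD_eq_getElem _ _ hr'] at hbit
    simp only [Bool.not_eq_true'] at hbit
    simp [BitCode.render, g, flip, hr', hbit]

theorem flatMap_getElem? {α β : Type*} (f : α → List β) {n : ℕ} {l : List α}
    (hl : ∀ x ∈ l, (f x).length = n) {q r : ℕ} (hr : r < n) :
    (l.flatMap f)[q * n + r]? = l[q]?.bind fun x => (f x)[r]? := by
  induction l generalizing q with
  | nil => simp
  | cons a l ih =>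
    have ha := hl a (by simp)
    cases q with
    | zero => simp [List.getElem?_append_left (ha ▸ hr)]
    | succ q =>
      have := ih (fun x hx => hl x (by simp [hx])) (q := q)
      rw [List.flatMap_cons, List.getElem?_append_right (by rw [ha, Nat.succ_mul]; omega), ha,
        show (q + 1) * n + r - n = q * n + r by rw [Nat.succ_mul]; omega, this]
      simp

theorem flatMap_length {α β : Type*} (f : α → List β) {n : ℕ} {l : List α}
    (hl : ∀ x ∈ l, (f x).length = n) : (l.flatMap f).length = l.length * n := by
  induction l with
  | nil => simp
  | cons a l ih =>
    rw [List.flatMap_cons, List.length_append, hl a (by simp),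
      ih fun x hx => hl x (by simp [hx]), List.length_cons]
    ring

/-- The sequence of pieces of an input string. -/
noncomputable def Idx.piece (y : Idx O) (q : ℕ) : Piece (Sym V) := (pieces y.name).getD q .blank

theorem Idx.pieces_c (u : V) :
    (u = P.s ∧ u ≠ P.t ∧ pieces (Idx.c u : Idx O).name = [.full, .full, .full, .full, .full, .full,
      .blank, .pos (.w u), .neg (.w u)]) ∨
    (u ≠ P.s ∧ u = P.t ∧ pieces (Idx.c u : Idx O).name = [.pos (.v u), .neg (.v u), .blank,
      .full, .full, .full, .full, .full, .full]) ∨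
    (u ≠ P.s ∧ u ≠ P.t ∧ pieces (Idx.c u : Idx O).name = [.pos (.v u), .neg (.v u), .blank,
      .full, .full, .full, .blank, .pos (.w u), .neg (.w u)]) := by
  by_cases hs : u = P.s
  · have ht : u ≠ P.t := hs ▸ P.s_ne_t
    exact .inl ⟨hs, ht, by
      simp only [name, strC, if_pos hs, if_neg ht, pieces, piecesL, piecesM, piecesR]; rfl⟩
  · by_cases ht : u = P.t
    · exact .inr (.inl ⟨hs, ht, by
        simp only [name, strC, if_neg hs, if_pos ht, pieces, piecesL, piecesM, piecesR]; rfl⟩)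
    · exact .inr (.inr ⟨hs, ht, by
        simp only [name, strC, if_neg hs, if_neg ht, pieces, piecesL, piecesM, piecesR]; rfl⟩)

theorem Idx.pieces_length (y : Idx O) : (pieces y.name).length = y.kind.size := by
  rcases y with e | e | u | u | u | u | u
  case c =>
    rcases Idx.pieces_c (O := O) u with ⟨-, -, h⟩ | ⟨-, -, h⟩ | ⟨-, -, h⟩ <;> rw [h] <;> rfl
  all_goals rfl

theorem Idx.piece_of_size_le (y : Idx O) {j : ℕ} (hj : y.kind.size ≤ j) :
    y.piece j = .blank :=
  List.getD_eq_default _ _ (y.pieces_length ▸ hj)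

theorem Idx.hasShape (y : Idx O) : HasShape y.kind y.piece := by
  have hsize := @Idx.piece_of_size_le _ _ _ y
  rcases y with e | e | u | u | u | u | u
  · exact ⟨.inr ⟨_, rfl, rfl, rfl⟩, .inr ⟨_, rfl, rfl, rfl⟩, .inr ⟨_, rfl, rfl, rfl⟩,
      fun j => hsize⟩
  · exact ⟨.inr ⟨_, rfl, rfl, rfl⟩, .inr ⟨_, rfl, rfl, rfl⟩, .inr ⟨_, rfl, rfl, rfl⟩,
      fun j => hsize⟩
  · rcases Idx.pieces_c (O := O) u with ⟨-, -, h⟩ | ⟨-, -, h⟩ | ⟨-, -, h⟩ <;>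
      refine ⟨?_, ?_, ?_, fun j => hsize⟩ <;> simp [HasBlock, Idx.piece, h]
  · exact ⟨⟨_, rfl, rfl, rfl⟩, fun j => hsize⟩
  · exact ⟨⟨_, rfl, rfl, rfl⟩, fun j => hsize⟩
  · exact ⟨⟨_, rfl, rfl, rfl⟩, fun j => hsize⟩
  · exact ⟨⟨_, rfl, rfl, rfl⟩, fun j => hsize⟩

theorem v_mem_letters (u : V) : Sym.v u ∈ letters P := .inl ⟨u, rfl⟩

theorem w_mem_letters {u : V} (hu : u ≠ P.t) : Sym.w u ∈ letters P := .inr ⟨u, hu, rfl⟩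

theorem Idx.letters_mem (y : Idx O) {p : Piece (Sym V)} (hp : p ∈ pieces y.name) (x : Sym V)
    (hx : p = .pos x ∨ p = .neg x) : x ∈ letters P := by
  rcases y with e | e | u | u | u | u | u
  · have := w_mem_letters (edge_ne_t e)
    have := v_mem_letters (P := P) (O.c e.1 (e.2 + 1))
    simp only [name, strA, pieces, piecesL, piecesM, piecesR, List.mem_append, List.mem_cons,
      List.not_mem_nil, or_false] at hp
    aesop
  · have := w_mem_letters (edge_ne_t e)
    have := v_mem_letters (P := P) (O.c e.1 (e.2 + 1))
    have := v_mem_letters (P := P) (O.c e.1 (e.2 + 1 + 1))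
    simp only [name, strB, pieces, piecesL, piecesM, piecesR, List.mem_append, List.mem_cons,
      List.not_mem_nil, or_false] at hp
    aesop
  · have := v_mem_letters (P := P) u
    have := w_mem_letters (P := P) (u := u)
    rcases Idx.pieces_c (O := O) u with ⟨-, ht, h⟩ | ⟨-, -, h⟩ | ⟨-, ht, h⟩ <;>
      simp only [h, List.mem_cons, List.not_mem_nil, or_false] at hp <;> aesop
  · have := w_mem_letters u.2
    simp only [name, pieces, piecesM, List.mem_cons, List.not_mem_nil, or_false] at hp
    aesop
  · have := w_mem_letters u.2
    simp only [name, pieces, piecesL, List.mem_cons, List.not_mem_nil, or_false] at hp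
    aesop
  · have := v_mem_letters (P := P) u.1
    simp only [name, pieces, piecesM, List.mem_cons, List.not_mem_nil, or_false] at hp
    aesop
  · have := v_mem_letters (P := P) u.1
    simp only [name, pieces, piecesR, List.mem_cons, List.not_mem_nil, or_false] at hp
    aesop

theorem Idx.lettersIn (y : Idx O) : LettersIn (letters P) y.piece := by
  intro q x hx
  by_cases hq : q < (pieces y.name).length
  · rw [Idx.piece, List.getD_eq_getElem _ _ hq] at hx
    exact y.letters_mem (List.getElem_mem hq) x hx
  · rw [Idx.piece, List.getD_eq_default _ _ (by omega)] at hx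
    simp at hx

theorem Idx.str_length (E : BitCode P) (i : ℕ) (y : Idx O) :
    (E.str i y.name).length = y.kind.size * E.len := by
  rw [E.str_eq, flatMap_length _ fun p hp => E.render_length i (y.letters_mem hp),
    y.pieces_length]

theorem Idx.str_getElem? (E : BitCode P) (i : ℕ) (y : Idx O) {q r : ℕ} (hr : r < E.len)
    (h : (y.piece q).bit E.bitAt r = true) :
    (E.str i y.name)[q * E.len + r]? = some (some i) := by
  rw [E.str_eq, flatMap_getElem? _ (fun p hp => E.render_length i (y.letters_mem hp)) hr]
  by_cases hq : q < (pieces y.name).length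
  · rw [Idx.piece, List.getD_eq_getElem _ _ hq] at h
    rw [List.getElem?_eq_getElem hq]
    exact E.render_getElem? i (y.letters_mem (List.getElem_mem hq)) hr h
  · rw [Idx.piece, List.getD_eq_default _ _ (by omega)] at h
    simp [Piece.bit] at h

theorem OccursEndingAt.getElem? {S Q : WStr} {e : ℕ} (h : OccursEndingAt S Q e) {j i : ℕ}
    (hj : S[j]? = some (some i)) : Q[e - S.length + j]? = some (some i) := by
  obtain ⟨h1, h2, h3⟩ := h
  unfold Matches at h3
  have hlen := h3.length_eq
  obtain ⟨hjS, hjv⟩ := List.getElem?_eq_some_iff.1 hj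
  have h4 := (List.forall₂_iff_get.1 h3).2 j hjS (hlen ▸ hjS)
  simp only [List.get_eq_getElem, hjv, reduceCtorEq, false_or] at h4
  have h5 : ((Q.take e).drop (e - S.length))[j]? = some (some i) := by
    rw [List.getElem?_eq_getElem (hlen ▸ hjS), ← h4]
  rw [List.getElem?_drop, List.getElem?_take] at h5
  split_ifs at h5 with h6
  exact h5

end

/-! ### Counting non-wildcards: the strings tile the text -/

section

variable {V : Type*} {P : RDHP V} {O : ChildOrder P}

/-- The index type as a sum type. -/
def Idx.equivSum (O : ChildOrder P) : Idx O ≃ (Edge O ⊕ Edge O) ⊕ V ⊕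
    ({u : V // u ≠ P.t} ⊕ {u : V // u ≠ P.t}) ⊕ ({u : V // u ≠ P.s} ⊕ {u : V // u ≠ P.s}) where
  toFun
    | .a e => .inl (.inl e)
    | .b e => .inl (.inr e)
    | .c u => .inr (.inl u)
    | .wM u => .inr (.inr (.inl (.inl u)))
    | .wL u => .inr (.inr (.inl (.inr u)))
    | .vM u => .inr (.inr (.inr (.inl u)))
    | .vR u => .inr (.inr (.inr (.inr u)))
  invFun
    | .inl (.inl e) => .a e
    | .inl (.inr e) => .b e
    | .inr (.inl u) => .c u
    | .inr (.inr (.inl (.inl u))) => .wM u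
    | .inr (.inr (.inl (.inr u))) => .wL u
    | .inr (.inr (.inr (.inl u))) => .vM u
    | .inr (.inr (.inr (.inr u))) => .vR u
  left_inv y := by cases y <;> rfl
  right_inv y := by rcases y with (_ | _) | _ | (_ | _) | (_ | _) <;> rfl

noncomputable instance [Finite V] : Fintype (Idx O) :=
  haveI := Finite.of_equiv _ (Idx.equivSum O).symm
  Fintype.ofFinite _

theorem Idx.sum_eq [Fintype V] [Fintype {u : V // u ≠ P.t}] [Fintype {u : V // u ≠ P.s}]
    (F : Idx O → ℕ) : ∑ y, F y = (∑ e, F (.a e) + ∑ e, F (.b e)) + (∑ u, F (.c u) +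
      ((∑ u, F (.wM u) + ∑ u, F (.wL u)) + (∑ u, F (.vM u) + ∑ u, F (.vR u)))) := by
  rw [← (Idx.equivSum O).symm.sum_comp]
  simp only [Fintype.sum_sum_type]
  rfl

/-- One inequality is enough, as only a lower bound on the total weight is needed. -/
theorem m_le_card_edge [Finite V] (O : ChildOrder P) : P.m ≤ Nat.card (Edge O) := by
  unfold RDHP.m
  rw [← Nat.card_coe_set_eq]
  let F : Edge O → {e : V × V | P.graph.Adj e.1 e.2} := fun e =>
    ⟨(e.1, (O.children e.1)[(e.2 : ℕ)]'e.2.2), (O.mem_children _ _).1 (List.getElem_mem _)⟩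
  refine Nat.card_le_card_of_surjective F ?_
  rintro ⟨⟨u, x⟩, h⟩
  obtain ⟨j, hj, hx⟩ := List.getElem_of_mem ((O.mem_children u x).2 h)
  exact ⟨⟨u, j, hj⟩, Subtype.ext (Prod.ext rfl hx)⟩

/-- The number of non-wildcards of a piece. -/
def Piece.weight {X : Type*} (b : X → ℕ → Bool) (l : ℕ) (p : Piece X) : ℕ :=
  ∑ r ∈ Finset.range l, if p.bit b r = true then 1 else 0

theorem weight_blank {X : Type*} (b : X → ℕ → Bool) (l : ℕ) :
    (Piece.blank : Piece X).weight b l = 0 := by simp [Piece.weight, Piece.bit]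

theorem weight_full {X : Type*} (b : X → ℕ → Bool) (l : ℕ) :
    (Piece.full : Piece X).weight b l = l := by simp [Piece.weight, Piece.bit]

theorem weight_pos_add_neg {X : Type*} (b : X → ℕ → Bool) (l : ℕ) (x : X) :
    (Piece.pos x).weight b l + (Piece.neg x).weight b l = l := by
  unfold Piece.weight
  rw [← Finset.sum_add_distrib]
  have : ∀ r ∈ Finset.range l, ((if (Piece.pos x).bit b r = true then 1 else 0) +
      if (Piece.neg x).bit b r = true then 1 else 0) = 1 := by
    intro r _
    cases h : b x r <;> simp [Piece.bit, h]
  rw [Finset.sum_congr rfl this]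
  simp

/-- The number of non-wildcards of an input string. -/
noncomputable def Idx.weight (b : Sym V → ℕ → Bool) (l : ℕ) (y : Idx O) : ℕ :=
  ∑ q ∈ Finset.range 9, (y.piece q).weight b l

/-- Summing over nine pieces for every string is harmless because shorter strings are padded with
blanks, which weigh nothing. -/
theorem Idx.weight_eq (b : Sym V → ℕ → Bool) (l : ℕ) (y : Idx O) : y.weight b l =
    ((pieces y.name).map (Piece.weight b l)).sum := by
  have hle : (pieces y.name).length ≤ 9 := by
    rw [y.pieces_length]; cases y.kind <;> simp [Kind.size]
  unfold Idx.weight Idx.piece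
  generalize pieces y.name = L at hle
  generalize 9 = n at hle
  induction L generalizing n with
  | nil => simp [weight_blank]
  | cons p L ih =>
    obtain ⟨n, rfl⟩ : ∃ m, n = m + 1 := ⟨n - 1, by simp at hle; omega⟩
    rw [Finset.sum_range_succ']
    simp only [List.getD_cons_succ, List.getD_cons_zero, List.map_cons, List.sum_cons]
    rw [ih n (by simpa using hle), add_comm]

theorem Idx.weight_a (b : Sym V → ℕ → Bool) (l : ℕ) (e : Edge O) :
    (Idx.a e).weight b l = 3 * l := by
  have h1 := weight_pos_add_neg b l (.w e.1)
  have h2 := weight_pos_add_neg b l (.v (O.c e.1 (e.2 + 1)))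
  have h3 := weight_blank b l
  rw [Idx.weight_eq]
  simp only [name, strA, pieces, piecesL, piecesM, piecesR, List.cons_append, List.nil_append,
    List.map_cons, List.map_nil, List.sum_cons, List.sum_nil]
  omega

theorem Idx.weight_b (b : Sym V → ℕ → Bool) (l : ℕ) (e : Edge O) :
    (Idx.b e).weight b l = 3 * l := by
  have h1 := weight_pos_add_neg b l (.w e.1)
  have h2 := weight_pos_add_neg b l (.v (O.c e.1 (e.2 + 1)))
  have h3 := weight_pos_add_neg b l (.v (O.c e.1 (e.2 + 1 + 1)))
  have h4 := weight_blank b l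
  rw [Idx.weight_eq]
  simp only [name, strB, pieces, piecesL, piecesM, piecesR, List.cons_append, List.nil_append,
    List.map_cons, List.map_nil, List.sum_cons, List.sum_nil]
  omega

open Classical in
theorem Idx.weight_c (b : Sym V → ℕ → Bool) (l : ℕ) (u : V) :
    (Idx.c u : Idx O).weight b l =
      5 * l + (if u = P.s then 2 * l else 0) + (if u = P.t then 2 * l else 0) := by
  have h1 := weight_pos_add_neg b l (.w u)
  have h2 := weight_pos_add_neg b l (.v u)
  have h3 := weight_blank (X := Sym V) b l
  have h4 := weight_full (X := Sym V) b l
  rw [Idx.weight_eq]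
  rcases Idx.pieces_c (O := O) u with ⟨hs, ht, h⟩ | ⟨hs, ht, h⟩ | ⟨hs, ht, h⟩ <;>
    simp only [h, List.map_cons, List.map_nil, List.sum_cons, List.sum_nil] <;>
    first
    | rw [if_pos hs, if_neg ht]
    | rw [if_neg hs, if_pos ht]
    | rw [if_neg hs, if_neg ht]
  all_goals omega

theorem Idx.weight_patch (b : Sym V → ℕ → Bool) (l : ℕ) (y : Idx O) (hy : y.kind ≠ .main) :
    y.weight b l = l := by
  have h3 := weight_blank (X := Sym V) b l
  have h4 := weight_pos_add_neg b l
  rw [Idx.weight_eq]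
  rcases y with e | e | u | u | u | u | u <;> simp only [Idx.kind, ne_eq, not_true] at hy
  · have := h4 (.w u)
    simp only [name, pieces, piecesM, List.map_cons, List.map_nil, List.sum_cons, List.sum_nil]
    omega
  · have := h4 (.w u)
    simp only [name, pieces, piecesL, List.map_cons, List.map_nil, List.sum_cons, List.sum_nil]
    omega
  · have := h4 (.v u)
    simp only [name, pieces, piecesM, List.map_cons, List.map_nil, List.sum_cons, List.sum_nil]
    omega
  · have := h4 (.v u)
    simp only [name, pieces, piecesR, List.map_cons, List.map_nil, List.sum_cons, List.sum_nil]
    omega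

/-- The input strings have as many non-wildcards as the text has positions. -/
theorem le_sum_weight [Finite V] (O : ChildOrder P) (b : Sym V → ℕ → Bool) (l : ℕ) :
    (2 * P.m + 3 * P.n) * (3 * l) ≤ ∑ y : Idx O, y.weight b l := by
  classical
  have := Fintype.ofFinite V
  have hm := m_le_card_edge O
  have hn : P.n = Fintype.card V := Nat.card_eq_fintype_card
  have hpos : 1 ≤ Fintype.card V := Fintype.card_pos_iff.2 ⟨P.s⟩
  have hcard : ∀ x : V, Fintype.card {u : V // u ≠ x} = Fintype.card V - 1 := fun x => by
    rw [Fintype.card_subtype_compl, Fintype.card_subtype_eq]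
  rw [Nat.card_eq_fintype_card] at hm
  rw [Idx.sum_eq]
  have hp : ∀ y : Idx O, y.kind ≠ .main → y.weight b l = l := Idx.weight_patch b l
  simp only [Idx.weight_a, Idx.weight_b, Idx.weight_c, Finset.sum_add_distrib,
    hp (.wM _) (by simp [Idx.kind]), hp (.wL _) (by simp [Idx.kind]),
    hp (.vM _) (by simp [Idx.kind]), hp (.vR _) (by simp [Idx.kind]), Finset.sum_const,
    Finset.card_univ, Finset.sum_ite_eq', Finset.mem_univ, if_true, smul_eq_mul, hcard, hn]
  -- Writing `n = k + 1` removes the truncated subtraction; what remains is `6m + (5n + 4) + 4(n -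
  -- 1) = 6m + 9n`.
  obtain ⟨k, hk⟩ : ∃ k, Fintype.card V = k + 1 := ⟨Fintype.card V - 1, by omega⟩
  rw [hk, Nat.add_sub_cancel]
  nlinarith [Nat.mul_le_mul_right l hm]

/-- The input strings stand in the text at the positions `s` (counted from `0`). -/
structure IsPlacement (E : BitCode P) (ι : Name V → ℕ) (Q : WStr) (s : Idx O → ℕ) : Prop where
  le_length : ∀ y, s y + y.kind.size * E.len ≤ Q.length
  char_eq : ∀ y q r, r < E.len → (y.piece q).bit E.bitAt r = true →
    Q[s y + q * E.len + r]? = some (some (ι y.name))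

variable {E : BitCode P} {ι : Name V → ℕ} {Q : WStr} {s : Idx O → ℕ}

theorem isPlacement_of_occurs {e : Idx O → ℕ}
    (he : ∀ y, OccursEndingAt (E.str (ι y.name) y.name) Q (e y)) :
    IsPlacement E ι Q fun y : Idx O => e y - y.kind.size * E.len := by
  refine ⟨fun y => ?_, fun y q r hr h => ?_⟩
  · have h1 := (he y).1
    have h2 := (he y).2.1
    rw [y.str_length] at h1
    omega
  · have := (he y).getElem? (y.str_getElem? E (ι y.name) hr h)
    rwa [y.str_length, ← add_assoc] at this

theorem IsPlacement.char_of_covers (hs : IsPlacement E ι Q s) {y : Idx O} {p : ℕ}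
    (h : Covers E.bitAt E.len y.piece (s y) p) : Q[p]? = some (some (ι y.name)) := by
  obtain ⟨q, r, hr, hbit, rfl⟩ := h
  exact hs.char_eq y q r hr hbit

/-- The character at `p` identifies the string. Allowing two different placements makes it possible
to compare occurrences. -/
theorem IsPlacement.eq_of_covers (hι : Set.InjOn ι (names O)) {s' : Idx O → ℕ}
    (hs : IsPlacement E ι Q s) (hs' : IsPlacement E ι Q s') {y z : Idx O} {p : ℕ}
    (h : Covers E.bitAt E.len y.piece (s y) p) (h' : Covers E.bitAt E.len z.piece (s' z) p) :
    y = z := by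
  have h1 := hs.char_of_covers h
  rw [hs'.char_of_covers h', Option.some_inj, Option.some_inj] at h1
  exact (Idx.name_injective (hι z.name_mem y.name_mem h1)).symm

/-- The non-wildcards of the input strings fill the whole text. -/
theorem IsPlacement.isTiling [Finite V] (hι : Set.InjOn ι (names O)) (hs : IsPlacement E ι Q s)
    (hQ : Q.length = (2 * P.m + 3 * P.n) * (3 * E.len)) :
    IsTiling E.bitAt E.len Q.length (fun y : Idx O => y.piece) s := by
  classical
  refine ⟨hs.eq_of_covers hι hs, ?_⟩
  let D : Finset (Idx O × ℕ × ℕ) :=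
    {x ∈ Finset.univ ×ˢ Finset.range 9 ×ˢ Finset.range E.len |
      (x.1.piece x.2.1).bit E.bitAt x.2.2 = true}
  let F : Idx O × ℕ × ℕ → ℕ := fun x => s x.1 + x.2.1 * E.len + x.2.2
  have hD : ∀ x ∈ D, x.2.2 < E.len ∧ (x.1.piece x.2.1).bit E.bitAt x.2.2 = true := by
    intro x hx
    simp only [D, Finset.mem_filter, Finset.mem_product, Finset.mem_range] at hx
    exact ⟨hx.1.2.2, hx.2⟩
  have hcard : D.card = ∑ y : Idx O, y.weight E.bitAt E.len := by
    simp only [D, Finset.card_filter, Finset.sum_product]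
    rfl
  have hinj : Set.InjOn F D := by
    rintro ⟨y, q, r⟩ hx ⟨y', q', r'⟩ hx' h
    obtain ⟨hr, hb⟩ := hD _ hx
    obtain ⟨hr', hb'⟩ := hD _ hx'
    simp only [F] at h hr hb hr' hb'
    obtain rfl : y = y' := hs.eq_of_covers hι hs (covers_of_bit hr hb h)
      (covers_of_bit hr' hb' rfl)
    have h1 : q * E.len + r = q' * E.len + r' := by omega
    have h2 : q = q' := by
      have := congrArg (· / E.len) h1
      have h0 : 0 < E.len := by omega
      simpa [Nat.add_div_of_dvd_right, Nat.mul_div_cancel _ h0, Nat.div_eq_of_lt hr,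
        Nat.div_eq_of_lt hr'] using this
    subst h2
    have h3 : r = r' := by omega
    rw [h3]
  have hsub : D.image F ⊆ Finset.range Q.length := by
    intro p hp
    obtain ⟨⟨y, q, r⟩, hx, rfl⟩ := Finset.mem_image.1 hp
    obtain ⟨hr, hb⟩ := hD _ hx
    have := hs.char_eq y q r hr hb
    exact Finset.mem_range.2 (List.getElem?_eq_some_iff.1 this).1
  -- Injectivity turns the weight bound into a cardinality bound, so no position of the text is left
  -- over.
  have heq : D.image F = Finset.range Q.length := by
    refine Finset.eq_of_subset_of_card_le hsub ?_
    rw [Finset.card_image_of_injOn hinj, hcard, Finset.card_range, hQ]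
    exact le_sum_weight O E.bitAt E.len
  intro p hp
  rw [← Finset.mem_range, ← heq, Finset.mem_image] at hp
  obtain ⟨⟨y, q, r⟩, hx, rfl⟩ := hp
  obtain ⟨hr, hb⟩ := hD _ hx
  exact ⟨y, covers_of_bit hr hb rfl⟩

/-- With `j` the offset of the first non-wildcard, position `s' y + j` carries the character of `y`,
so in the tiling given by `s` it is covered by `y` too, at an offset of at least `j`. -/
theorem IsPlacement.le [Finite V] (hι : Set.InjOn ι (names O)) {s' : Idx O → ℕ}
    (hs : IsPlacement E ι Q s) (hs' : IsPlacement E ι Q s')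
    (hQ : Q.length = (2 * P.m + 3 * P.n) * (3 * E.len)) (y : Idx O) : s y ≤ s' y := by
  classical
  have hshift : ∀ {t j}, Covers E.bitAt E.len y.piece t (t + j) ↔
      Covers E.bitAt E.len y.piece 0 j := fun {t j} =>
    ⟨fun ⟨q, r, hr, hb, h⟩ => ⟨q, r, hr, hb, by omega⟩,
      fun ⟨q, r, hr, hb, h⟩ => ⟨q, r, hr, hb, by omega⟩⟩
  have hb := E.isCode
  have hex : ∃ j, Covers E.bitAt E.len y.piece 0 j := by
    have hne := y.hasShape.lead_ne
    refine ⟨_, (covers_shift (t := 0) (a := y.kind.lead)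
      fun j hj => y.hasShape.eq_blank_of_lt hj).1 (covers_firstPos hb _ ?_)⟩
    simpa using hne
  obtain ⟨j, hj, hmin⟩ : ∃ j, Covers E.bitAt E.len y.piece 0 j ∧
      ∀ i, Covers E.bitAt E.len y.piece 0 i → j ≤ i :=
    ⟨Nat.find hex, Nat.find_spec hex, fun i hi => Nat.find_min' hex hi⟩
  have hc' := (hshift (t := s' y)).2 hj
  have hlt : s' y + j < Q.length := (List.getElem?_eq_some_iff.1 (hs'.char_of_covers hc')).1
  obtain ⟨z, hz⟩ := (hs.isTiling hι hQ).exists_cover _ hlt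
  obtain rfl := hs.eq_of_covers hι hs' hz hc'
  have hle : s z ≤ s' z + j := by
    obtain ⟨q, r, -, -, h⟩ := hz
    omega
  obtain ⟨i, hi⟩ := Nat.exists_eq_add_of_le hle
  rw [hi, hshift] at hz
  have := hmin i hz
  omega

/-- Pigeonhole: an injective `f` whose values all occur among those of `g`, on the same finite set,
exhausts the values of `g`. -/
theorem exists_eq_of_injective {M : Type*} [Finite M] {f g : M → ℕ} (hf : Function.Injective f)
    (h : ∀ m, ∃ m', f m = g m') (m' : M) : ∃ m, g m' = f m := by
  choose φ hφ using h
  have hinj : Function.Injective φ := fun m₁ m₂ h => hf (by rw [hφ, hφ, h])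
  obtain ⟨m, rfl⟩ := Finite.injective_iff_surjective.1 hinj m'
  exact ⟨m, (hφ m).symm⟩

/-! ### Excluding shifted patch strings -/

section Counting

variable {n : ℕ} {τ : Idx O → ℕ}

theorem Idx.piece_c_zero {u : V} (hu : u ≠ P.s) : (Idx.c u : Idx O).piece 0 = .pos (.v u) := by
  rcases Idx.pieces_c (O := O) u with ⟨hs, ht, h⟩ | ⟨hs, ht, h⟩ | ⟨hs, ht, h⟩
  · exact absurd hs hu
  all_goals rw [Idx.piece, h]; rfl

theorem Idx.piece_c_eight {u : V} (hu : u ≠ P.t) : (Idx.c u : Idx O).piece 8 = .neg (.w u) := by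
  rcases Idx.pieces_c (O := O) u with ⟨hs, ht, h⟩ | ⟨hs, ht, h⟩ | ⟨hs, ht, h⟩
  · rw [Idx.piece, h]; rfl
  · exact absurd ht hu
  · rw [Idx.piece, h]; rfl

theorem Idx.piece_c_middle (u : V) :
    (Idx.c u : Idx O).piece 3 = .full ∧ (Idx.c u : Idx O).piece 5 = .full := by
  rcases Idx.pieces_c (O := O) u with ⟨hs, ht, h⟩ | ⟨hs, ht, h⟩ | ⟨hs, ht, h⟩ <;>
    simp [Idx.piece, h]

/-- The patch strings of right parts are not shifted: there are as many left parts as middle parts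
for the letters in `V`. -/
theorem IsCellTiling.right_mod [Finite V]
    (hT : IsCellTiling n fun y : Idx O => cell y.piece (τ y))
    (hn : ∀ y : Idx O, τ y + y.kind.size ≤ n) (hal : ∀ y : Idx O, y.kind.Aligned (τ y))
    (u : {u : V // u ≠ P.s}) : τ (.vR u) % 3 = 0 := by
  by_contra hmod
  have hmod2 : τ (.vR u) % 3 = 2 := by
    have : τ (.vR u) % 3 ≠ 1 := hal (.vR u)
    omega
  -- `f` lists the columns of the left parts with a `V` letter (in `B` and `C` strings), `g` those
  -- of the middle parts with a `V` letter (in `A` strings, at offset 3, and in patches). The common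
  -- index type records that there are equally many.
  let f : Edge O ⊕ {u : V // u ≠ P.s} → ℕ
    | .inl e => τ (.b e)
    | .inr u => τ (.c u)
  let g : Edge O ⊕ {u : V // u ≠ P.s} → ℕ
    | .inl e => τ (.a e) + 3
    | .inr u => τ (.vM u)
  let nm : Edge O ⊕ {u : V // u ≠ P.s} → Idx O
    | .inl e => .b e
    | .inr u => .c u
  have hpos : ∀ m, ∃ x, cell (nm m).piece (τ (nm m)) (f m) = .pos (.v x) := by
    rintro (e | u)
    · exact ⟨_, cell_add (Idx.b e).piece (τ (.b e)) 0⟩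
    · exact ⟨_, (cell_add (Idx.c u : Idx O).piece (τ (.c u)) 0).trans (Idx.piece_c_zero u.2)⟩
  have hg : ∀ (y : Idx O) (q : ℕ) (x : V), q % 3 = 0 → q < n →
      cell y.piece (τ y) q = .pos (.v x) → ∃ m, q = g m := by
    intro y q x hq hqn hy
    obtain ⟨z, hz⟩ : ∃ z : Idx O, cell z.piece (τ z) q = .neg (.v x) := by
      rcases hT.exists_cell q hqn with ⟨z, hz⟩ | ⟨a, z, z', hz, hz'⟩
      · have := hT.full_unique hz (z := y) (by simp [hy])
        subst this
        simp [hy] at hz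
      · obtain rfl := hT.pos_unique hz hy
        rw [hy] at hz
        simp only [Piece.pos.injEq] at hz
        exact ⟨z', hz ▸ hz'⟩
    rcases z.hasShape.neg_first (hal z) hq hz with ⟨hk, hqz, hp⟩ | ⟨hk, hqz, hp⟩ <;>
      rcases z with e | e | u | u | u | u | u <;> simp only [Idx.kind, reduceCtorEq] at hk
    · exact ⟨.inl e, hqz⟩
    · exact absurd hp (by simp [Idx.piece, Idx.name, strB, pieces, piecesL, piecesM])
    · simp [(Idx.piece_c_middle (O := O) u).1] at hp
    · exact absurd hp (by simp [Idx.piece, Idx.name, pieces, piecesM])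
    · exact ⟨.inr u, hqz⟩
  have hmain : ∀ m, (nm m).kind = .main ∧ f m = τ (nm m) := by rintro (e | u) <;> exact ⟨rfl, rfl⟩
  have hfinj : Function.Injective f := by
    intro m₁ m₂ h
    obtain ⟨x₁, h₁⟩ := hpos m₁
    obtain ⟨x₂, h₂⟩ := hpos m₂
    have h3 : nm m₁ = nm m₂ := hT.pos_unique h₁ (h ▸ h₂)
    rcases m₁ with e₁ | u₁ <;> rcases m₂ with e₂ | u₂ <;> simp only [nm, reduceCtorEq, Idx.b.injEq,
      Idx.c.injEq] at h3
    · rw [h3]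
    · rw [Subtype.ext h3]
  have hfg : ∀ m, ∃ m', f m = g m' := by
    intro m
    obtain ⟨x, hx⟩ := hpos m
    have h1 := hal (nm m)
    have h2 := hn (nm m)
    rw [(hmain m).1] at h1 h2
    have h3 := (hmain m).2
    simp only [Kind.Aligned, Kind.size] at h1 h2
    exact hg (nm m) (f m) x (by omega) (by omega) hx
  have hu : cell (Idx.vR u : Idx O).piece (τ (.vR u)) (τ (.vR u) + 1) = .pos (.v u) :=
    cell_add (Idx.vR u : Idx O).piece (τ (.vR u)) 1
  have hnu : τ (.vR u) + 3 ≤ n := hn (.vR u)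
  -- The shifted patch would need a middle part of its own, but each one is already paired with the
  -- left part of an encoded triple.
  obtain ⟨m', hm'⟩ := hg (.vR u) _ _ (by omega) (by omega) hu
  obtain ⟨m, hm⟩ := exists_eq_of_injective hfinj hfg m'
  obtain ⟨x, hx⟩ := hpos m
  rw [← hm, ← hm'] at hx
  have : Idx.vR u = nm m := hT.pos_unique hu hx
  rcases m with e | u <;> simp [nm] at this

/-- The patch strings of left parts are not shifted: there are as many right parts as middle parts
for the letters in `W`. -/
theorem IsCellTiling.left_mod [Finite V]
    (hT : IsCellTiling n fun y : Idx O => cell y.piece (τ y))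
    (hn : ∀ y : Idx O, τ y + y.kind.size ≤ n) (hal : ∀ y : Idx O, y.kind.Aligned (τ y))
    (u : {u : V // u ≠ P.t}) : τ (.wL u) % 3 = 0 := by
  by_contra hmod
  have hmod2 : τ (.wL u) % 3 = 1 := by
    have : τ (.wL u) % 3 ≠ 2 := hal (.wL u)
    omega
  -- Mirror image of the argument for right patches, in third columns: right parts with a `W` letter
  -- (in `A` and `C` strings, last piece at offset 8) against middle parts with a `W` letter (in `B`
  -- strings, last piece at offset 5, and in patches, at offset 2).
  let nm : Edge O ⊕ {u : V // u ≠ P.t} → Idx O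
    | .inl e => .a e
    | .inr u => .c u
  let f : Edge O ⊕ {u : V // u ≠ P.t} → ℕ := fun m => τ (nm m) + 8
  let g : Edge O ⊕ {u : V // u ≠ P.t} → ℕ
    | .inl e => τ (.b e) + 5
    | .inr u => τ (.wM u) + 2
  have hneg : ∀ m, ∃ x, cell (nm m).piece (τ (nm m)) (f m) = .neg (.w x) := by
    rintro (e | u)
    · exact ⟨_, cell_add (Idx.a e).piece (τ (.a e)) 8⟩
    · exact ⟨_, (cell_add (Idx.c u : Idx O).piece (τ (.c u)) 8).trans (Idx.piece_c_eight u.2)⟩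
  have hg : ∀ (y : Idx O) (q : ℕ) (x : V), q % 3 = 2 → q < n →
      cell y.piece (τ y) q = .neg (.w x) → ∃ m, q = g m := by
    intro y q x hq hqn hy
    obtain ⟨z, hz⟩ : ∃ z : Idx O, cell z.piece (τ z) q = .pos (.w x) := by
      rcases hT.exists_cell q hqn with ⟨z, hz⟩ | ⟨a, z, z', hz, hz'⟩
      · have := hT.full_unique hz (z := y) (by simp [hy])
        subst this
        simp [hy] at hz
      · obtain rfl := hT.neg_unique hz' hy
        rw [hy] at hz'
        simp only [Piece.neg.injEq] at hz'
        exact ⟨z, hz' ▸ hz⟩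
    rcases z.hasShape.pos_third (hal z) hq hz with ⟨hk, hqz, hp⟩ | ⟨hk, hqz, hp⟩ <;>
      rcases z with e | e | u | u | u | u | u <;> simp only [Idx.kind, reduceCtorEq] at hk
    · exact absurd hp (by simp [Idx.piece, Idx.name, strA, pieces, piecesL, piecesM])
    · exact ⟨.inl e, hqz⟩
    · simp [(Idx.piece_c_middle (O := O) u).2] at hp
    · exact ⟨.inr u, hqz⟩
    · exact absurd hp (by simp [Idx.piece, Idx.name, pieces, piecesM])
  have hfinj : Function.Injective f := by
    intro m₁ m₂ h
    obtain ⟨x₁, h₁⟩ := hneg m₁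
    obtain ⟨x₂, h₂⟩ := hneg m₂
    have h3 : nm m₁ = nm m₂ := hT.neg_unique h₁ (h ▸ h₂)
    rcases m₁ with e₁ | u₁ <;> rcases m₂ with e₂ | u₂ <;> simp only [nm, reduceCtorEq, Idx.a.injEq,
      Idx.c.injEq] at h3
    · rw [h3]
    · rw [Subtype.ext h3]
  have hmain : ∀ m, (nm m).kind = .main := by rintro (e | u) <;> rfl
  have hfg : ∀ m, ∃ m', f m = g m' := by
    intro m
    obtain ⟨x, hx⟩ := hneg m
    have h1 := hal (nm m)
    have h2 := hn (nm m)
    rw [hmain m] at h1 h2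
    simp only [Kind.Aligned, Kind.size] at h1 h2
    exact hg (nm m) (f m) x (by simp only [f]; omega) (by simp only [f]; omega) hx
  have hu : cell (Idx.wL u : Idx O).piece (τ (.wL u)) (τ (.wL u) + 1) = .neg (.w u) :=
    cell_add (Idx.wL u : Idx O).piece (τ (.wL u)) 1
  have hnu : τ (.wL u) + 3 ≤ n := hn (.wL u)
  obtain ⟨m', hm'⟩ := hg (.wL u) _ _ (by omega) (by omega) hu
  obtain ⟨m, hm⟩ := exists_eq_of_injective hfinj hfg m'
  obtain ⟨x, hx⟩ := hneg m
  rw [← hm, ← hm'] at hx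
  have : Idx.wL u = nm m := hT.neg_unique hu hx
  rcases m with e | u <;> simp [nm] at this

end Counting

/-- All input strings stand at multiples of the block length. -/
theorem IsPlacement.dvd [Finite V] (hι : Set.InjOn ι (names O)) (hs : IsPlacement E ι Q s)
    (hQ : Q.length = (2 * P.m + 3 * P.n) * (3 * E.len)) (y : Idx O) : 3 * E.len ∣ s y := by
  have hT := hs.isTiling hι hQ
  have hb := E.isCode
  have h8 := hb.eight_le
  have hQ' : Q.length = (3 * (2 * P.m + 3 * P.n)) * E.len := by rw [hQ]; ring
  have hdvd : ∀ y, E.len ∣ s y := by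
    refine hT.dvd hb (a := fun y => y.kind.lead) (fun y j hj => y.hasShape.eq_blank_of_lt hj)
      (fun y => y.hasShape.lead_ne) Idx.lettersIn hQ' fun y => ?_
    have h1 := hs.le_length y
    have h2 : y.kind.lead + 1 ≤ y.kind.size := by cases y.kind <;> simp [Kind.lead, Kind.size]
    have h3 := Nat.mul_le_mul_right E.len h2
    rw [Nat.add_mul, one_mul] at h3
    omega
  choose τ hτ using hdvd
  have hτ' : ∀ y, s y = τ y * E.len := fun y => by rw [hτ, mul_comm]
  have hC := hT.isCellTiling hb Idx.lettersIn hQ' hτ'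
  have hn : ∀ y, τ y + y.kind.size ≤ 3 * (2 * P.m + 3 * P.n) := by
    intro y
    have h1 := hs.le_length y
    rw [hτ', hQ', ← Nat.add_mul] at h1
    exact Nat.le_of_mul_le_mul_right h1 (by omega)
  have hal := hC.aligned Idx.hasShape hn rfl
  have hmod : τ y % 3 = 0 := by
    rcases y with e | e | u | u | u | u | u
    · exact hal (.a e)
    · exact hal (.b e)
    · exact hal (.c u)
    · exact hal (.wM u)
    · exact hC.left_mod hn hal u
    · exact hal (.vM u)
    · exact hC.right_mod hn hal u
  rw [hτ']
  exact Nat.mul_dvd_mul_right (Nat.dvd_of_mod_eq_zero hmod) _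

end

end Soda

theorem mainTheorem4 {V : Type*} [Finite V] (P : Soda.RDHP V) (O : Soda.ChildOrder P)
    (E : Soda.BitCode P) (ι : Soda.Name V → ℕ) (hι : Set.InjOn ι (Soda.names O))
    (Q : Soda.WStr) (hQ : Q.length = (2 * P.m + 3 * P.n) * (3 * E.len))
    (hmatch : ∀ S ∈ Soda.setT' O E ι, Soda.HasMatch S Q) :
    ∀ S ∈ Soda.setT' O E ι,
      ∃ e, Soda.OccursEndingAt S Q e ∧ 3 * E.len ∣ e ∧
        ∀ e', Soda.OccursEndingAt S Q e' → e' = e := by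
  classical
  rintro S ⟨x, hx, rfl⟩
  obtain ⟨y, rfl⟩ := Soda.Idx.exists_name_eq hx
  have hex : ∀ z : Soda.Idx O, ∃ e, Soda.OccursEndingAt (E.str (ι z.name) z.name) Q e :=
    fun z => hmatch _ ⟨z.name, z.name_mem, rfl⟩
  choose e he using hex
  have hs := Soda.isPlacement_of_occurs he
  have hlen : ∀ {e'}, Soda.OccursEndingAt (E.str (ι y.name) y.name) Q e' →
      y.kind.size * E.len ≤ e' := fun h => y.str_length E (ι y.name) ▸ h.1
  refine ⟨e y, he y, ?_, fun e' he' => ?_⟩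
  · have h1 := hs.dvd hι hQ y
    have h2 : 3 * E.len ∣ y.kind.size * E.len := by
      refine Nat.mul_dvd_mul_right ?_ _
      cases y.kind <;> simp [Soda.Kind.size]
    have h3 := Nat.dvd_add h1 h2
    rwa [Nat.sub_add_cancel (hlen (he y))] at h3
  -- Moving only `y` to its other occurrence gives a second placement, to be compared with the first
  -- in both directions.
  · have hs' : Soda.IsPlacement E ι Q fun z : Soda.Idx O =>
        Function.update e y e' z - z.kind.size * E.len := by
      refine Soda.isPlacement_of_occurs fun z => ?_
      by_cases hz : z = y
      · subst hz; simpa using he'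
      · simpa [hz] using he z
    have h1 := hs.le hι hs' hQ y
    have h2 := hs'.le hι hs hQ y
    have h3 := hlen (he y)
    have h4 := hlen he'
    simp only [Function.update_self] at h1 h2
    omega
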